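/- Let $k$ be a commutative ring and let $C(k)$ be the category of unbounded ($\mathbb{Z}$-graded) complexes of $k$-modules. Let $\mathcal{O}$ be an operad in $C(k)$ (symmetric and unital, with complexes of operations $\mathcal{O}(r)$, $r\ge 0$). Let $s\in\mathbb{Z}$, let $M=\mathrm{cone}(\mathrm{id}_k)[s]$ be the shifted cone of the identity of $k$ (regarded as a complex concentrated in degree $0$), and let $n\ge 0$ be an integer. Let $F(M,n)$ denote the free operad generated by the complex $M$ placed in arity $n$, that is, the operad such that morphisms of operads $F(M,n)\to\mathcal{P}$ correspond naturally to morphisms of complexes $M\to\mathcal{P}(n)$. Let $\mathcal{O}\sqcup F(M,n)$ be the coproduct in the category of operads in $C(k)$. Suppose that either (i) $\mathcal{O}(0)=0$ and $n>0$, or (ii) $k\supseteq\mathbb{Q}$, i.e. there is a ring homomorphism $\mathbb{Q}\to k$. Then the canonical morphism $\mathcal{O}\to\mathcal{O}\sqcup F(M,n)$ is a componentwise quasi-isomorphism: for every $r\ge 0$ the morphism of complexes $\mathcal{O}(r)\to(\mathcal{O}\sqcup F(M,n))(r)$ is a quasi-isomorphism. -/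

import Mathlib

open CategoryTheory CategoryTheory.Limits

universe u

/-- A (symmetric, unital) operad in the category of unbounded complexes of `k`-modules, presented
through partial compositions.

An element of `cx n` is an operation whose inputs are labelled by `Fin n`. For `a` in `cx m`, `b` in
`cx n`, an input `i` of `a`, and a bijection `e` from the remaining inputs (those of `a` other than
`i`, together with those of `b`) to `Fin l`, the element `comp i e a b` of `cx l` is
`a` with `b` inserted at the input `i`, where the remaining inputs are relabelled through `e`.
The usual `a ∘ᵢ b` is the case where `e` is the standard order on the remaining inputs, and
`comp i e a b` is then a permutation applied to `a ∘ᵢ b`. -/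
structure DGOperad (k : Type u) [CommRing k] where
  /-- The complex of `n`-ary operations. -/
  cx : ℕ → CochainComplex (ModuleCat.{u} k) ℤ
  /-- The (left) action of the symmetric group: `act σ` renames the input `x` to `σ x`. -/
  act {n : ℕ} (σ : Equiv.Perm (Fin n)) : cx n ⟶ cx n
  act_one (n : ℕ) : act (1 : Equiv.Perm (Fin n)) = 𝟙 (cx n)
  act_mul {n : ℕ} (σ τ : Equiv.Perm (Fin n)) : act (σ * τ) = act τ ≫ act σ
  /-- The unit operation, a cocycle of degree zero. -/
  one : (cx 1).X 0
  d_one : (cx 1).d 0 1 one = 0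
  /-- Partial composition, a `k`-bilinear map that adds degrees. -/
  comp {m n l : ℕ} (i : Fin m) (e : {x : Fin m // x ≠ i} ⊕ Fin n ≃ Fin l)
    {p q r : ℤ} (h : p + q = r) : (cx m).X p →ₗ[k] (cx n).X q →ₗ[k] (cx l).X r
  /-- Partial composition is a morphism of complexes from the tensor product. -/
  d_comp {m n l : ℕ} (i : Fin m) (e : {x : Fin m // x ≠ i} ⊕ Fin n ≃ Fin l)
    {p q r p' q' r' : ℤ} (h : p + q = r) (hp : p + 1 = p') (hq : q + 1 = q') (hr : r + 1 = r')
    (h₁ : p' + q = r') (h₂ : p + q' = r') (a : (cx m).X p) (b : (cx n).X q) :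
    (cx l).d r r' (comp i e h a b) =
      comp i e h₁ ((cx m).d p p' a) b + p.negOnePow • comp i e h₂ a ((cx n).d q q' b)
  /-- Equivariance in the output. -/
  act_comp {m n l : ℕ} (i : Fin m) (e : {x : Fin m // x ≠ i} ⊕ Fin n ≃ Fin l)
    (ρ : Equiv.Perm (Fin l)) {p q r : ℤ} (h : p + q = r) (a : (cx m).X p) (b : (cx n).X q) :
    (act ρ).f r (comp i e h a b) = comp i (e.trans ρ) h a b
  /-- Equivariance in the inputs. -/
  comp_act {m n l : ℕ} (i : Fin m) (σ : Equiv.Perm (Fin m)) (τ : Equiv.Perm (Fin n))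
    (e : {x : Fin m // x ≠ σ i} ⊕ Fin n ≃ Fin l) (e' : {x : Fin m // x ≠ i} ⊕ Fin n ≃ Fin l)
    (h₁ : ∀ x hx hx', e (.inl ⟨σ x, hx⟩) = e' (.inl ⟨x, hx'⟩))
    (h₂ : ∀ y, e (.inr (τ y)) = e' (.inr y))
    {p q r : ℤ} (h : p + q = r) (a : (cx m).X p) (b : (cx n).X q) :
    comp (σ i) e h ((act σ).f p a) ((act τ).f q b) = comp i e' h a b
  /-- Left unit law. -/
  one_comp {n : ℕ} (i : Fin 1) (e : {x : Fin 1 // x ≠ i} ⊕ Fin n ≃ Fin n)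
    (he : ∀ y, e (.inr y) = y) {q : ℤ} (b : (cx n).X q) :
    comp i e (zero_add q) one b = b
  /-- Right unit law. -/
  comp_one {m : ℕ} (i : Fin m) (e : {x : Fin m // x ≠ i} ⊕ Fin 1 ≃ Fin m)
    (he : ∀ x, e (.inl x) = x.1) {p : ℤ} (a : (cx m).X p) :
    comp i e (add_zero p) a one = a
  /-- Sequential associativity: `(a ∘ᵢ b) ∘ⱼ c = a ∘ᵢ (b ∘ⱼ c)` for an input `j` of `b`. -/
  assoc {m n q u v l : ℕ} (i : Fin m) (j : Fin n)
    (e : {x : Fin m // x ≠ i} ⊕ Fin n ≃ Fin u)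
    (f : {x : Fin u // x ≠ e (.inr j)} ⊕ Fin q ≃ Fin l)
    (f' : {x : Fin n // x ≠ j} ⊕ Fin q ≃ Fin v)
    (e' : {x : Fin m // x ≠ i} ⊕ Fin v ≃ Fin l)
    (h₁ : ∀ x hx, f (.inl ⟨e (.inl x), hx⟩) = e' (.inl x))
    (h₂ : ∀ y hy, f (.inl ⟨e (.inr y.1), hy⟩) = e' (.inr (f' (.inl y))))
    (h₃ : ∀ z, f (.inr z) = e' (.inr (f' (.inr z))))
    {α β γ δ ε ζ : ℤ} (hαβ : α + β = δ) (hδγ : δ + γ = ζ) (hβγ : β + γ = ε) (hαε : α + ε = ζ)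
    (a : (cx m).X α) (b : (cx n).X β) (c : (cx q).X γ) :
    comp (e (.inr j)) f hδγ (comp i e hαβ a b) c = comp i e' hαε a (comp j f' hβγ b c)
  /-- Parallel associativity: `(a ∘ᵢ b) ∘ⱼ c = (-1) ^ (|b| |c|) (a ∘ⱼ c) ∘ᵢ b` for distinct inputs
  `i` and `j` of `a`. -/
  parallel {m n q u v l : ℕ} (i j : Fin m) (hji : j ≠ i) (hij : i ≠ j)
    (e : {x : Fin m // x ≠ i} ⊕ Fin n ≃ Fin u)
    (f : {x : Fin u // x ≠ e (.inl ⟨j, hji⟩)} ⊕ Fin q ≃ Fin l)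
    (e' : {x : Fin m // x ≠ j} ⊕ Fin q ≃ Fin v)
    (f' : {x : Fin v // x ≠ e' (.inl ⟨i, hij⟩)} ⊕ Fin n ≃ Fin l)
    (h₁ : ∀ x hi hj hx hx',
      f (.inl ⟨e (.inl ⟨x, hi⟩), hx⟩) = f' (.inl ⟨e' (.inl ⟨x, hj⟩), hx'⟩))
    (h₂ : ∀ y hy, f (.inl ⟨e (.inr y), hy⟩) = f' (.inr y))
    (h₃ : ∀ z hz, f (.inr z) = f' (.inl ⟨e' (.inr z), hz⟩))
    {α β γ δ ε ζ : ℤ} (hαβ : α + β = δ) (hδγ : δ + γ = ζ) (hαγ : α + γ = ε) (hεβ : ε + β = ζ)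
    (a : (cx m).X α) (b : (cx n).X β) (c : (cx q).X γ) :
    comp (e (.inl ⟨j, hji⟩)) f hδγ (comp i e hαβ a b) c =
      (β * γ).negOnePow • comp (e' (.inl ⟨i, hij⟩)) f' hεβ (comp j e' hαγ a c) b

namespace DGOperad

variable {k : Type u} [CommRing k]

/-- Morphisms of operads. -/
@[ext]
structure Hom (O P : DGOperad k) where
  /-- The morphism of complexes in arity `n`. -/
  app (n : ℕ) : O.cx n ⟶ P.cx n
  map_act {n : ℕ} (σ : Equiv.Perm (Fin n)) : O.act σ ≫ app n = app n ≫ P.act σ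
  map_one : (app 1).f 0 O.one = P.one
  map_comp {m n l : ℕ} (i : Fin m) (e : {x : Fin m // x ≠ i} ⊕ Fin n ≃ Fin l)
    {p q r : ℤ} (h : p + q = r) (a : (O.cx m).X p) (b : (O.cx n).X q) :
    (app l).f r (O.comp i e h a b) = P.comp i e h ((app m).f p a) ((app n).f q b)

instance : Category.{u} (DGOperad k) where
  Hom := Hom
  id O :=
    { app := fun n => 𝟙 _
      map_act := by simp
      map_one := by simp
      map_comp := by simp }
  comp f g :=
    { app := fun n => f.app n ≫ g.app n
      map_act := fun σ => by
        rw [← Category.assoc, f.map_act, Category.assoc, g.map_act, Category.assoc]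
      map_one := by simp [f.map_one, g.map_one]
      map_comp := by intros; simp [f.map_comp, g.map_comp] }

@[simp]
theorem id_app (O : DGOperad k) (n : ℕ) : Hom.app (𝟙 O) n = 𝟙 (O.cx n) := rfl

@[simp]
theorem comp_app {O P Q : DGOperad k} (f : O ⟶ P) (g : P ⟶ Q) (n : ℕ) :
    Hom.app (f ≫ g) n = f.app n ≫ g.app n := rfl

@[ext]
theorem hom_ext {O P : DGOperad k} {f g : O ⟶ P} (h : ∀ n, f.app n = g.app n) : f = g :=
  Hom.ext (funext h)

end DGOperad

/-! ### Operads given by generators and relations -/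

/-- Formal operadic expressions of arity `n` and degree `p` in a family `G` of generators. -/
inductive OpTerm (k : Type u) (G : ℕ → ℤ → Type u) : ℕ → ℤ → Type u
  | gen {n : ℕ} {p : ℤ} (x : G n p) : OpTerm k G n p
  | zero (n : ℕ) (p : ℤ) : OpTerm k G n p
  | add {n : ℕ} {p : ℤ} (s t : OpTerm k G n p) : OpTerm k G n p
  | smul {n : ℕ} {p : ℤ} (c : k) (t : OpTerm k G n p) : OpTerm k G n p
  | diff {n : ℕ} {p p' : ℤ} (h : p + 1 = p') (t : OpTerm k G n p) : OpTerm k G n p'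
  | act {n : ℕ} {p : ℤ} (σ : Equiv.Perm (Fin n)) (t : OpTerm k G n p) : OpTerm k G n p
  | one : OpTerm k G 1 0
  | comp {m n l : ℕ} (i : Fin m) (e : {x : Fin m // x ≠ i} ⊕ Fin n ≃ Fin l)
      {p q r : ℤ} (h : p + q = r) (s : OpTerm k G m p) (t : OpTerm k G n q) : OpTerm k G l r

/-- The operadic congruence on formal expressions generated by relations `R`. -/
inductive OpRel {k : Type u} [CommRing k] {G : ℕ → ℤ → Type u}
    (R : ∀ n p, OpTerm k G n p → OpTerm k G n p → Prop) :
    ∀ {n : ℕ} {p : ℤ}, OpTerm k G n p → OpTerm k G n p → Prop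
  | rel {n p s t} : R n p s t → OpRel R s t
  | refl {n p} (s : OpTerm k G n p) : OpRel R s s
  | symm {n p} {s t : OpTerm k G n p} : OpRel R s t → OpRel R t s
  | trans {n p} {s t v : OpTerm k G n p} : OpRel R s t → OpRel R t v → OpRel R s v
  | add_congr {n p} {s s' t t' : OpTerm k G n p} :
      OpRel R s s' → OpRel R t t' → OpRel R (s.add t) (s'.add t')
  | smul_congr {n p} (c : k) {s s' : OpTerm k G n p} :
      OpRel R s s' → OpRel R (s.smul c) (s'.smul c)
  | diff_congr {n p p'} (h : p + 1 = p') {s s' : OpTerm k G n p} :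
      OpRel R s s' → OpRel R (s.diff h) (s'.diff h)
  | act_congr {n p} (σ : Equiv.Perm (Fin n)) {s s' : OpTerm k G n p} :
      OpRel R s s' → OpRel R (s.act σ) (s'.act σ)
  | comp_congr {m n l : ℕ} (i : Fin m) (e : {x : Fin m // x ≠ i} ⊕ Fin n ≃ Fin l)
      {p q r : ℤ} (h : p + q = r) {s s' : OpTerm k G m p} {t t' : OpTerm k G n q} :
      OpRel R s s' → OpRel R t t' → OpRel R (.comp i e h s t) (.comp i e h s' t')
  | add_assoc {n p} (s t v : OpTerm k G n p) : OpRel R ((s.add t).add v) (s.add (t.add v))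
  | add_comm {n p} (s t : OpTerm k G n p) : OpRel R (s.add t) (t.add s)
  | zero_add {n p} (s : OpTerm k G n p) : OpRel R ((OpTerm.zero n p).add s) s
  | smul_add {n p} (c : k) (s t : OpTerm k G n p) :
      OpRel R ((s.add t).smul c) ((s.smul c).add (t.smul c))
  | add_smul {n p} (c c' : k) (s : OpTerm k G n p) :
      OpRel R (s.smul (c + c')) ((s.smul c).add (s.smul c'))
  | mul_smul {n p} (c c' : k) (s : OpTerm k G n p) :
      OpRel R (s.smul (c * c')) ((s.smul c').smul c)
  | one_smul {n p} (s : OpTerm k G n p) : OpRel R (s.smul 1) s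
  | zero_smul {n p} (s : OpTerm k G n p) : OpRel R (s.smul 0) (OpTerm.zero n p)
  | diff_add {n p p'} (h : p + 1 = p') (s t : OpTerm k G n p) :
      OpRel R ((s.add t).diff h) ((s.diff h).add (t.diff h))
  | diff_smul {n p p'} (h : p + 1 = p') (c : k) (s : OpTerm k G n p) :
      OpRel R ((s.smul c).diff h) ((s.diff h).smul c)
  | diff_diff {n p p' p''} (h : p + 1 = p') (h' : p' + 1 = p'') (s : OpTerm k G n p) :
      OpRel R ((s.diff h).diff h') (OpTerm.zero n p'')
  | act_add {n p} (σ : Equiv.Perm (Fin n)) (s t : OpTerm k G n p) :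
      OpRel R ((s.add t).act σ) ((s.act σ).add (t.act σ))
  | act_smul {n p} (σ : Equiv.Perm (Fin n)) (c : k) (s : OpTerm k G n p) :
      OpRel R ((s.smul c).act σ) ((s.act σ).smul c)
  | act_diff {n p p'} (σ : Equiv.Perm (Fin n)) (h : p + 1 = p') (s : OpTerm k G n p) :
      OpRel R ((s.diff h).act σ) ((s.act σ).diff h)
  | act_one {n p} (s : OpTerm k G n p) : OpRel R (s.act 1) s
  | act_mul {n p} (σ τ : Equiv.Perm (Fin n)) (s : OpTerm k G n p) :
      OpRel R (s.act (σ * τ)) ((s.act τ).act σ)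
  | diff_one : OpRel R (OpTerm.one.diff (_root_.zero_add 1)) (OpTerm.zero 1 1)
  | comp_add_left {m n l : ℕ} (i : Fin m) (e : {x : Fin m // x ≠ i} ⊕ Fin n ≃ Fin l)
      {p q r : ℤ} (h : p + q = r) (s s' : OpTerm k G m p) (t : OpTerm k G n q) :
      OpRel R (.comp i e h (s.add s') t) ((OpTerm.comp i e h s t).add (.comp i e h s' t))
  | comp_add_right {m n l : ℕ} (i : Fin m) (e : {x : Fin m // x ≠ i} ⊕ Fin n ≃ Fin l)
      {p q r : ℤ} (h : p + q = r) (s : OpTerm k G m p) (t t' : OpTerm k G n q) :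
      OpRel R (.comp i e h s (t.add t')) ((OpTerm.comp i e h s t).add (.comp i e h s t'))
  | comp_smul_left {m n l : ℕ} (i : Fin m) (e : {x : Fin m // x ≠ i} ⊕ Fin n ≃ Fin l)
      {p q r : ℤ} (h : p + q = r) (c : k) (s : OpTerm k G m p) (t : OpTerm k G n q) :
      OpRel R (.comp i e h (s.smul c) t) ((OpTerm.comp i e h s t).smul c)
  | comp_smul_right {m n l : ℕ} (i : Fin m) (e : {x : Fin m // x ≠ i} ⊕ Fin n ≃ Fin l)
      {p q r : ℤ} (h : p + q = r) (c : k) (s : OpTerm k G m p) (t : OpTerm k G n q) :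
      OpRel R (.comp i e h s (t.smul c)) ((OpTerm.comp i e h s t).smul c)
  | diff_comp {m n l : ℕ} (i : Fin m) (e : {x : Fin m // x ≠ i} ⊕ Fin n ≃ Fin l)
      {p q r p' q' r' : ℤ} (h : p + q = r) (hp : p + 1 = p') (hq : q + 1 = q') (hr : r + 1 = r')
      (h₁ : p' + q = r') (h₂ : p + q' = r') (s : OpTerm k G m p) (t : OpTerm k G n q) :
      OpRel R ((OpTerm.comp i e h s t).diff hr)
        ((OpTerm.comp i e h₁ (s.diff hp) t).add
          ((OpTerm.comp i e h₂ s (t.diff hq)).smul ((p.negOnePow : ℤ) : k)))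
  | act_comp {m n l : ℕ} (i : Fin m) (e : {x : Fin m // x ≠ i} ⊕ Fin n ≃ Fin l)
      (ρ : Equiv.Perm (Fin l)) {p q r : ℤ} (h : p + q = r)
      (s : OpTerm k G m p) (t : OpTerm k G n q) :
      OpRel R ((OpTerm.comp i e h s t).act ρ) (OpTerm.comp i (e.trans ρ) h s t)
  | comp_act {m n l : ℕ} (i : Fin m) (σ : Equiv.Perm (Fin m)) (τ : Equiv.Perm (Fin n))
      (e : {x : Fin m // x ≠ σ i} ⊕ Fin n ≃ Fin l) (e' : {x : Fin m // x ≠ i} ⊕ Fin n ≃ Fin l)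
      (h₁ : ∀ x hx hx', e (.inl ⟨σ x, hx⟩) = e' (.inl ⟨x, hx'⟩))
      (h₂ : ∀ y, e (.inr (τ y)) = e' (.inr y))
      {p q r : ℤ} (h : p + q = r) (s : OpTerm k G m p) (t : OpTerm k G n q) :
      OpRel R (OpTerm.comp (σ i) e h (s.act σ) (t.act τ)) (OpTerm.comp i e' h s t)
  | one_comp {n : ℕ} (i : Fin 1) (e : {x : Fin 1 // x ≠ i} ⊕ Fin n ≃ Fin n)
      (he : ∀ y, e (.inr y) = y) {q : ℤ} (t : OpTerm k G n q) :
      OpRel R (OpTerm.comp i e (_root_.zero_add q) OpTerm.one t) t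
  | comp_one {m : ℕ} (i : Fin m) (e : {x : Fin m // x ≠ i} ⊕ Fin 1 ≃ Fin m)
      (he : ∀ x, e (.inl x) = x.1) {p : ℤ} (s : OpTerm k G m p) :
      OpRel R (OpTerm.comp i e (add_zero p) s OpTerm.one) s
  | assoc {m n q u v l : ℕ} (i : Fin m) (j : Fin n)
      (e : {x : Fin m // x ≠ i} ⊕ Fin n ≃ Fin u)
      (f : {x : Fin u // x ≠ e (.inr j)} ⊕ Fin q ≃ Fin l)
      (f' : {x : Fin n // x ≠ j} ⊕ Fin q ≃ Fin v)
      (e' : {x : Fin m // x ≠ i} ⊕ Fin v ≃ Fin l)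
      (h₁ : ∀ x hx, f (.inl ⟨e (.inl x), hx⟩) = e' (.inl x))
      (h₂ : ∀ y hy, f (.inl ⟨e (.inr y.1), hy⟩) = e' (.inr (f' (.inl y))))
      (h₃ : ∀ z, f (.inr z) = e' (.inr (f' (.inr z))))
      {α β γ δ ε ζ : ℤ} (hαβ : α + β = δ) (hδγ : δ + γ = ζ) (hβγ : β + γ = ε) (hαε : α + ε = ζ)
      (a : OpTerm k G m α) (b : OpTerm k G n β) (c : OpTerm k G q γ) :
      OpRel R (OpTerm.comp (e (.inr j)) f hδγ (.comp i e hαβ a b) c)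
        (OpTerm.comp i e' hαε a (.comp j f' hβγ b c))
  | parallel {m n q u v l : ℕ} (i j : Fin m) (hji : j ≠ i) (hij : i ≠ j)
      (e : {x : Fin m // x ≠ i} ⊕ Fin n ≃ Fin u)
      (f : {x : Fin u // x ≠ e (.inl ⟨j, hji⟩)} ⊕ Fin q ≃ Fin l)
      (e' : {x : Fin m // x ≠ j} ⊕ Fin q ≃ Fin v)
      (f' : {x : Fin v // x ≠ e' (.inl ⟨i, hij⟩)} ⊕ Fin n ≃ Fin l)
      (h₁ : ∀ x hi hj hx hx',
        f (.inl ⟨e (.inl ⟨x, hi⟩), hx⟩) = f' (.inl ⟨e' (.inl ⟨x, hj⟩), hx'⟩))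
      (h₂ : ∀ y hy, f (.inl ⟨e (.inr y), hy⟩) = f' (.inr y))
      (h₃ : ∀ z hz, f (.inr z) = f' (.inl ⟨e' (.inr z), hz⟩))
      {α β γ δ ε ζ : ℤ} (hαβ : α + β = δ) (hδγ : δ + γ = ζ) (hαγ : α + γ = ε) (hεβ : ε + β = ζ)
      (a : OpTerm k G m α) (b : OpTerm k G n β) (c : OpTerm k G q γ) :
      OpRel R (OpTerm.comp (e (.inl ⟨j, hji⟩)) f hδγ (.comp i e hαβ a b) c)
        ((OpTerm.comp (e' (.inl ⟨i, hij⟩)) f' hεβ (.comp j e' hαγ a c) b).smul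
          (((β * γ).negOnePow : ℤ) : k))

section Presented

variable {k : Type u} [CommRing k] {G : ℕ → ℤ → Type u}
  (R : ∀ n p, OpTerm k G n p → OpTerm k G n p → Prop)

/-- The setoid of the operadic congruence. -/
def opSetoid (n : ℕ) (p : ℤ) : Setoid (OpTerm k G n p) where
  r := OpRel R
  iseqv := ⟨OpRel.refl, OpRel.symm, OpRel.trans⟩

/-- Formal expressions modulo the operadic congruence. -/
def OpQuot (n : ℕ) (p : ℤ) : Type u := Quotient (opSetoid R n p)

namespace OpQuot

variable {R} {n : ℕ} {p : ℤ}

/-- The class of a formal expression. -/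
def mk (t : OpTerm k G n p) : OpQuot R n p := Quotient.mk (opSetoid R n p) t

theorem sound {s t : OpTerm k G n p} (h : OpRel R s t) : (mk s : OpQuot R n p) = mk t :=
  Quotient.sound (s := opSetoid R n p) h

theorem ind {P : OpQuot R n p → Prop} (h : ∀ t, P (mk t)) (x : OpQuot R n p) : P x :=
  Quotient.inductionOn x h

instance : Zero (OpQuot R n p) := ⟨mk (.zero n p)⟩

instance : Add (OpQuot R n p) :=
  ⟨Quotient.map₂ OpTerm.add fun _ _ h _ _ h' => OpRel.add_congr h h'⟩

instance : SMul k (OpQuot R n p) :=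
  ⟨fun c => Quotient.map (OpTerm.smul c) fun _ _ h => OpRel.smul_congr c h⟩

theorem mk_add (s t : OpTerm k G n p) : (mk (s.add t) : OpQuot R n p) = mk s + mk t := rfl

theorem mk_smul (c : k) (t : OpTerm k G n p) : (mk (t.smul c) : OpQuot R n p) = c • mk t := rfl

theorem mk_zero : (mk (.zero n p) : OpQuot R n p) = 0 := rfl

theorem zero_add' (x : OpQuot R n p) : 0 + x = x := by
  induction x using ind
  exact sound (.zero_add _)

theorem add_comm' (x y : OpQuot R n p) : x + y = y + x := by
  induction x using ind
  induction y using ind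
  exact sound (.add_comm _ _)

theorem zero_smul' (x : OpQuot R n p) : (0 : k) • x = 0 := by
  induction x using ind
  exact sound (.zero_smul _)

theorem add_smul' (c c' : k) (x : OpQuot R n p) : (c + c') • x = c • x + c' • x := by
  induction x using ind
  exact sound (.add_smul _ _ _)

theorem one_smul' (x : OpQuot R n p) : (1 : k) • x = x := by
  induction x using ind
  exact sound (.one_smul _)

theorem mul_smul' (c c' : k) (x : OpQuot R n p) : (c * c') • x = c • c' • x := by
  induction x using ind
  exact sound (.mul_smul _ _ _)

theorem smul_add' (c : k) (x y : OpQuot R n p) : c • (x + y) = c • x + c • y := by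
  induction x using ind
  induction y using ind
  exact sound (.smul_add _ _ _)

instance : Neg (OpQuot R n p) := ⟨fun x => (-1 : k) • x⟩

instance : AddCommGroup (OpQuot R n p) where
  add_assoc x y z := by
    induction x using ind
    induction y using ind
    induction z using ind
    exact sound (.add_assoc _ _ _)
  zero_add := zero_add'
  add_zero x := by rw [add_comm', zero_add']
  add_comm := add_comm'
  nsmul := nsmulRec
  zsmul := zsmulRec
  neg_add_cancel x := by
    change (-1 : k) • x + x = 0
    conv_lhs => rw [← one_smul' x, ← mul_smul', ← add_smul']
    simp [zero_smul']

instance : Module k (OpQuot R n p) where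
  one_smul := one_smul'
  mul_smul := mul_smul'
  smul_zero c := by
    rw [← zero_smul' (0 : OpQuot R n p), ← mul_smul', mul_zero]
  smul_add := smul_add'
  add_smul := add_smul'
  zero_smul := zero_smul'

/-- The differential. -/
def diff {p' : ℤ} (h : p + 1 = p') : OpQuot R n p →ₗ[k] OpQuot R n p' where
  toFun := Quotient.map (OpTerm.diff h) fun _ _ h' => OpRel.diff_congr h h'
  map_add' x y := by
    induction x using ind
    induction y using ind
    exact sound (.diff_add _ _ _)
  map_smul' c x := by
    induction x using ind
    exact sound (.diff_smul _ _ _)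

theorem mk_diff {p' : ℤ} (h : p + 1 = p') (t : OpTerm k G n p) :
    (mk (t.diff h) : OpQuot R n p') = diff h (mk t) := rfl

/-- The action of permutations. -/
def act (σ : Equiv.Perm (Fin n)) : OpQuot R n p →ₗ[k] OpQuot R n p where
  toFun := Quotient.map (OpTerm.act σ) fun _ _ h' => OpRel.act_congr σ h'
  map_add' x y := by
    induction x using ind
    induction y using ind
    exact sound (.act_add _ _ _)
  map_smul' c x := by
    induction x using ind
    exact sound (.act_smul _ _ _)

/-- The partial compositions. -/
def comp {m n l : ℕ} (i : Fin m) (e : {x : Fin m // x ≠ i} ⊕ Fin n ≃ Fin l)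
    {p q r : ℤ} (h : p + q = r) : OpQuot R m p →ₗ[k] OpQuot R n q →ₗ[k] OpQuot R l r :=
  LinearMap.mk₂ k
    (Quotient.map₂ (OpTerm.comp i e h) fun _ _ h₁ _ _ h₂ => OpRel.comp_congr i e h h₁ h₂)
    (fun x y z => by
      induction x using ind
      induction y using ind
      induction z using ind
      exact sound (.comp_add_left _ _ _ _ _ _))
    (fun c x y => by
      induction x using ind
      induction y using ind
      exact sound (.comp_smul_left _ _ _ _ _ _))
    (fun x y z => by
      induction x using ind
      induction y using ind
      induction z using ind
      exact sound (.comp_add_right _ _ _ _ _ _))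
    (fun c x y => by
      induction x using ind
      induction y using ind
      exact sound (.comp_smul_right _ _ _ _ _ _))

theorem units_smul (c : ℤˣ) (x : OpQuot R n p) : c • x = ((c : ℤ) : k) • x := by
  rw [Int.cast_smul_eq_zsmul]
  rfl

variable (R) in
/-- The complex of classes of formal expressions of arity `n`. -/
def cx (n : ℕ) : CochainComplex (ModuleCat.{u} k) ℤ where
  X p := ModuleCat.of k (OpQuot R n p)
  d p p' := if h : p + 1 = p' then ModuleCat.ofHom (diff h) else 0
  shape p p' h := dif_neg h
  d_comp_d' p p' p'' h h' := by
    have h1 : p + 1 = p' := h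
    have h2 : p' + 1 = p'' := h'
    rw [dif_pos h1, dif_pos h2]
    ext x
    induction x using ind
    exact sound (.diff_diff _ _ _)

theorem cx_d_apply {p' : ℤ} (h : p + 1 = p') (x : OpQuot R n p) :
    ((cx R n).d p p').hom x = diff h x := by
  have : (cx R n).d p p' = ModuleCat.ofHom (diff h) := dif_pos h
  rw [this]
  rfl

variable (R) in
/-- The action of permutations on the complex of classes of formal expressions. -/
def cxAct (σ : Equiv.Perm (Fin n)) : cx R n ⟶ cx R n where
  f p := ModuleCat.ofHom (act σ)
  comm' p p' h := by
    have h1 : p + 1 = p' := h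
    have : (cx R n).d p p' = ModuleCat.ofHom (diff h1) := dif_pos h1
    rw [this]
    ext x
    induction x using ind
    exact (sound (.act_diff _ _ _)).symm

end OpQuot

open OpQuot in
/-- The operad with generators `G` and relations `R`. -/
def presentedOperad : DGOperad k where
  cx := OpQuot.cx R
  act σ := cxAct R σ
  act_one n := by
    ext p x
    induction x using ind
    exact sound (.act_one _)
  act_mul σ τ := by
    ext p x
    induction x using ind
    exact sound (.act_mul _ _ _)
  one := OpQuot.mk .one
  d_one := (cx_d_apply (zero_add 1) _).trans (sound .diff_one)
  comp i e _ _ _ h := OpQuot.comp i e h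
  d_comp i e _ _ _ _ _ _ h hp hq hr h₁ h₂ a b := by
    induction a using ind
    induction b using ind
    refine (cx_d_apply hr _).trans ?_
    refine (sound (.diff_comp i e h hp hq hr h₁ h₂ _ _)).trans ?_
    rw [mk_add, mk_smul]
    erw [cx_d_apply hp, cx_d_apply hq, units_smul]
    rfl
  act_comp i e ρ _ _ _ h a b := by
    induction a using ind
    induction b using ind
    exact sound (.act_comp _ _ _ _ _ _)
  comp_act i σ τ e e' h₁ h₂ _ _ _ h a b := by
    induction a using ind
    induction b using ind
    exact sound (.comp_act _ _ _ _ _ h₁ h₂ _ _ _)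
  one_comp i e he _ b := by
    induction b using ind
    exact sound (.one_comp _ _ he _)
  comp_one i e he _ b := by
    induction b using ind
    exact sound (.comp_one _ _ he _)
  assoc i j e f f' e' h₁ h₂ h₃ _ _ _ _ _ _ hαβ hδγ hβγ hαε a b c := by
    induction a using ind
    induction b using ind
    induction c using ind
    exact sound (.assoc _ _ _ _ _ _ h₁ h₂ h₃ _ _ _ _ _ _ _)
  parallel i j hji hij e f e' f' h₁ h₂ h₃ _ _ _ _ _ _ hαβ hδγ hαγ hεβ a b c := by
    induction a using ind
    induction b using ind
    induction c using ind
    refine (sound (.parallel _ _ hji hij _ _ _ _ h₁ h₂ h₃ hαβ hδγ hαγ hεβ _ _ _)).trans ?_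
    rw [mk_smul]
    erw [units_smul]
    rfl

/-- The value in an operad `P` of a formal expression, given the values of the generators. -/
def OpTerm.value (P : DGOperad k) (φ : ∀ n p, G n p → (P.cx n).X p) :
    ∀ {n : ℕ} {p : ℤ}, OpTerm k G n p → (P.cx n).X p
  | _, _, .gen x => φ _ _ x
  | _, _, .zero _ _ => 0
  | _, _, .add s t => s.value P φ + t.value P φ
  | _, _, .smul c t => c • t.value P φ
  | _, _, .diff (p := p) (p' := p') _ t => (P.cx _).d p p' (t.value P φ)
  | _, _, .act σ t => (P.act σ).f _ (t.value P φ)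
  | _, _, .one => P.one
  | _, _, .comp i e h s t => P.comp i e h (s.value P φ) (t.value P φ)

variable {R}

theorem OpTerm.value_eq_of_rel (P : DGOperad k) (φ : ∀ n p, G n p → (P.cx n).X p)
    (hφ : ∀ n p s t, R n p s t → s.value P φ = t.value P φ) {n : ℕ} {p : ℤ}
    {s t : OpTerm k G n p} (h : OpRel R s t) : s.value P φ = t.value P φ := by
  have hu : ∀ (c : ℤˣ) {n : ℕ} {p : ℤ} (x : (P.cx n).X p), c • x = ((c : ℤ) : k) • x := by
    intro c n p x
    rw [Int.cast_smul_eq_zsmul]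
    rfl
  induction h with
  | rel h => exact hφ _ _ _ _ h
  | refl => rfl
  | symm _ ih => exact ih.symm
  | trans _ _ ih ih' => exact ih.trans ih'
  | add_congr _ _ ih ih' => simp only [OpTerm.value, ih, ih']
  | smul_congr _ _ ih => simp only [OpTerm.value, ih]
  | diff_congr _ _ ih => simp only [OpTerm.value, ih]
  | act_congr _ _ ih => simp only [OpTerm.value, ih]
  | comp_congr _ _ _ _ _ ih ih' => simp only [OpTerm.value, ih, ih']
  | add_assoc => exact add_assoc _ _ _
  | add_comm => exact add_comm _ _
  | zero_add => exact zero_add _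
  | smul_add => exact smul_add _ _ _
  | add_smul => exact add_smul _ _ _
  | mul_smul => exact mul_smul _ _ _
  | one_smul => exact one_smul _ _
  | zero_smul => exact zero_smul _ _
  | diff_add => exact map_add _ _ _
  | diff_smul => exact (ModuleCat.Hom.hom _).map_smul _ _
  | diff_diff =>
    simp only [OpTerm.value]
    rw [← ConcreteCategory.comp_apply, HomologicalComplex.d_comp_d]
    rfl
  | act_add => exact map_add _ _ _
  | act_smul => exact (ModuleCat.Hom.hom _).map_smul _ _
  | act_diff σ h s =>
    simp only [OpTerm.value]
    rw [← ConcreteCategory.comp_apply, ← ConcreteCategory.comp_apply, HomologicalComplex.Hom.comm]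
  | act_one => simp [OpTerm.value, P.act_one]
  | act_mul => simp [OpTerm.value, P.act_mul]
  | diff_one => exact P.d_one
  | comp_add_left => simp [OpTerm.value]
  | comp_add_right => simp [OpTerm.value]
  | comp_smul_left => simp [OpTerm.value]
  | comp_smul_right => simp [OpTerm.value]
  | diff_comp i e h hp hq hr h₁ h₂ =>
    simp only [OpTerm.value]
    rw [P.d_comp i e h hp hq hr h₁ h₂, hu]
  | act_comp => exact P.act_comp _ _ _ _ _ _
  | comp_act i σ τ e e' h₁ h₂ => exact P.comp_act _ _ _ _ _ h₁ h₂ _ _ _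
  | one_comp i e he => exact P.one_comp _ _ he _
  | comp_one i e he => exact P.comp_one _ _ he _
  | assoc i j e f f' e' h₁ h₂ h₃ => exact P.assoc _ _ _ _ _ _ h₁ h₂ h₃ _ _ _ _ _ _ _
  | parallel i j hji hij e f e' f' h₁ h₂ h₃ hαβ hδγ hαγ hεβ =>
    simp only [OpTerm.value]
    rw [P.parallel i j hji hij e f e' f' h₁ h₂ h₃ hαβ hδγ hαγ hεβ, hu]

namespace presentedOperad

/-- The class of a generator. -/
def gen {n : ℕ} {p : ℤ} (x : G n p) : ((presentedOperad R).cx n).X p :=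
  OpQuot.mk (.gen x)

/-- The class of a formal expression is its value at the classes of the generators. -/
theorem value_gen {n : ℕ} {p : ℤ} (t : OpTerm k G n p) :
    t.value (presentedOperad R) (fun _ _ x => gen x) = OpQuot.mk t := by
  induction t with
  | gen x => rfl
  | zero => rfl
  | add s t hs ht => simp only [OpTerm.value, hs, ht]; rfl
  | smul c t ht => simp only [OpTerm.value, ht]; rfl
  | diff h t ht => simp only [OpTerm.value, ht]; exact OpQuot.cx_d_apply h _
  | act σ t ht => simp only [OpTerm.value, ht]; rfl
  | one => rfl
  | comp i e h s t hs ht => simp only [OpTerm.value, hs, ht]; rfl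

theorem gen_rel {n : ℕ} {p : ℤ} {s t : OpTerm k G n p} (h : R n p s t) :
    s.value (presentedOperad R) (fun _ _ x => gen x) =
      t.value (presentedOperad R) (fun _ _ x => gen x) := by
  rw [value_gen, value_gen]
  exact OpQuot.sound (.rel h)

/-- A morphism of operads commutes with taking values. -/
theorem map_value {P Q : DGOperad k} (f : P ⟶ Q) (φ : ∀ n p, G n p → (P.cx n).X p)
    {n : ℕ} {p : ℤ} (t : OpTerm k G n p) :
    (f.app n).f p (t.value P φ) = t.value Q (fun n p x => (f.app n).f p (φ n p x)) := by
  induction t with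
  | gen x => rfl
  | zero => exact map_zero _
  | add s t hs ht => simp only [OpTerm.value, ← hs, ← ht]; exact map_add _ _ _
  | smul c t ht =>
    simp only [OpTerm.value, ← ht]; exact (ModuleCat.Hom.hom _).map_smul _ _
  | diff h t ht =>
    simp only [OpTerm.value, ← ht]
    rw [← ConcreteCategory.comp_apply, ← ConcreteCategory.comp_apply, HomologicalComplex.Hom.comm]
  | act σ t ht =>
    simp only [OpTerm.value, ← ht]
    rw [← ConcreteCategory.comp_apply, ← ConcreteCategory.comp_apply,
      ← HomologicalComplex.comp_f, ← HomologicalComplex.comp_f, f.map_act]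
  | one => exact f.map_one
  | comp i e h s t hs ht => simp only [OpTerm.value, ← hs, ← ht]; exact f.map_comp _ _ _ _ _

/-- Two morphisms that agree on the generators are equal. -/
theorem hom_ext_gen {P : DGOperad k} {f g : presentedOperad R ⟶ P}
    (h : ∀ n p (x : G n p), (f.app n).f p (gen x) = (g.app n).f p (gen x)) : f = g := by
  ext n p x
  induction x using OpQuot.ind with
  | h t =>
    have hf := map_value f (fun _ _ x => gen x) t
    have hg := map_value g (fun _ _ x => gen x) t
    rw [value_gen] at hf hg
    refine hf.trans (Eq.trans ?_ hg.symm)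
    congr 1
    funext n p x
    exact h n p x

/-- The morphism to `P` determined by the values of the generators. -/
def desc (P : DGOperad k) (φ : ∀ n p, G n p → (P.cx n).X p)
    (hφ : ∀ n p s t, R n p s t → s.value P φ = t.value P φ) : presentedOperad R ⟶ P :=
  DGOperad.Hom.mk
    (fun n =>
      { f := fun p => ModuleCat.ofHom
          { toFun := Quotient.lift (OpTerm.value P φ) fun _ _ h => OpTerm.value_eq_of_rel P φ hφ h
            map_add' := fun x y => by
              induction x using OpQuot.ind
              induction y using OpQuot.ind
              rfl
            map_smul' := fun c x => by
              induction x using OpQuot.ind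
              rfl }
        comm' := fun p p' h => by
          have h1 : p + 1 = p' := h
          have : (OpQuot.cx R n).d p p' = ModuleCat.ofHom (OpQuot.diff h1) := dif_pos h1
          ext x
          induction x using OpQuot.ind with
          | h t =>
            change _ = ModuleCat.Hom.hom ((OpQuot.cx R n).d p p' ≫ _) _
            rw [this]
            rfl })
    (fun σ => by
      ext p x
      induction x using OpQuot.ind
      rfl)
    rfl
    (fun i e _ _ _ h a b => by
      induction a using OpQuot.ind
      induction b using OpQuot.ind
      rfl)

@[simp]
theorem desc_gen (P : DGOperad k) (φ : ∀ n p, G n p → (P.cx n).X p)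
    (hφ : ∀ n p s t, R n p s t → s.value P φ = t.value P φ) {n : ℕ} {p : ℤ} (x : G n p) :
    ((desc P φ hφ).app n).f p (gen x) = φ n p x := rfl

end presentedOperad

end Presented

/-! ### Free operads -/

section Free

variable {k : Type u} [CommRing k]

/-- The generators of the free operad on a complex `M` placed in arity `n`: the elements of `M`. -/
inductive FreeGen (M : CochainComplex (ModuleCat.{u} k) ℤ) (n : ℕ) : ℕ → ℤ → Type u
  | mk {p : ℤ} (x : M.X p) : FreeGen M n n p

/-- The relations of the free operad: those expressing that `M` maps in as a complex. -/
inductive FreeRel (M : CochainComplex (ModuleCat.{u} k) ℤ) (n : ℕ) :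
    ∀ m p, OpTerm k (FreeGen M n) m p → OpTerm k (FreeGen M n) m p → Prop
  | add {p : ℤ} (x y : M.X p) :
      FreeRel M n n p (.gen (.mk (x + y))) (.add (.gen (.mk x)) (.gen (.mk y)))
  | smul {p : ℤ} (c : k) (x : M.X p) :
      FreeRel M n n p (.gen (.mk (c • x))) (.smul c (.gen (.mk x)))
  | diff {p p' : ℤ} (h : p + 1 = p') (x : M.X p) :
      FreeRel M n n p' (.gen (.mk (M.d p p' x))) (.diff h (.gen (.mk x)))

/-- The free operad `F(M, n)` generated by the complex `M` of `n`-ary operations. -/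
def freeOperad (M : CochainComplex (ModuleCat.{u} k) ℤ) (n : ℕ) : DGOperad k :=
  presentedOperad (FreeRel M n)

namespace freeOperad

variable (M : CochainComplex (ModuleCat.{u} k) ℤ) (n : ℕ)

/-- The inclusion of the generators. -/
def incl : M ⟶ (freeOperad M n).cx n where
  f p := ModuleCat.ofHom
    { toFun := fun x => presentedOperad.gen (.mk x)
      map_add' := fun x y => OpQuot.sound (.rel (.add x y))
      map_smul' := fun c x => OpQuot.sound (.rel (.smul c x)) }
  comm' p p' h := by
    ext x
    exact (OpQuot.cx_d_apply (n := n) h _).trans (OpQuot.sound (.rel (.diff h x))).symm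

variable {M n}

/-- The morphism of operads that extends a morphism of complexes `M ⟶ P(n)`. -/
def lift {P : DGOperad k} (g : M ⟶ P.cx n) : freeOperad M n ⟶ P :=
  presentedOperad.desc P
    (fun _ p x => match x with | .mk y => g.f p y)
    (fun _ _ s t h => by
      cases h with
      | add x y => exact map_add _ _ _
      | smul c x => exact (ModuleCat.Hom.hom _).map_smul _ _
      | diff h x =>
        simp only [OpTerm.value]
        rw [← ConcreteCategory.comp_apply, ← ConcreteCategory.comp_apply,
          HomologicalComplex.Hom.comm])

/-- The universal property of the free operad: morphisms of operads `F(M, n) ⟶ P` are the same as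
morphisms of complexes `M ⟶ P(n)`. -/
def homEquiv (P : DGOperad k) : (freeOperad M n ⟶ P) ≃ (M ⟶ P.cx n) where
  toFun f := incl M n ≫ f.app n
  invFun := lift
  left_inv f := by
    refine presentedOperad.hom_ext_gen fun m p x => ?_
    cases x with
    | mk y => rfl
  right_inv g := by
    ext p x
    rfl

end freeOperad

end Free

/-! ### Coproducts of operads -/

section Coproducts

variable {k : Type u} [CommRing k] {J : Type} (O : J → DGOperad k)

/-- The generators of the coproduct of a family of operads: all their operations. -/
def SumGen (n : ℕ) (p : ℤ) : Type u := Σ j, ((O j).cx n).X p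

/-- An operation of a member of the family, as a formal expression. -/
def sumTerm (j : J) {n : ℕ} {p : ℤ} (x : ((O j).cx n).X p) : OpTerm k (SumGen O) n p :=
  .gen (G := SumGen O) ⟨j, x⟩

/-- The relations of the coproduct: those expressing that each member maps in as an operad. -/
inductive SumRel : ∀ n p, OpTerm k (SumGen O) n p → OpTerm k (SumGen O) n p → Prop
  | add (j : J) {n : ℕ} {p : ℤ} (x y : ((O j).cx n).X p) :
      SumRel n p (sumTerm O j (x + y)) (.add (sumTerm O j x) (sumTerm O j y))
  | smul (j : J) {n : ℕ} {p : ℤ} (c : k) (x : ((O j).cx n).X p) :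
      SumRel n p (sumTerm O j (c • x)) (.smul c (sumTerm O j x))
  | diff (j : J) {n : ℕ} {p p' : ℤ} (h : p + 1 = p') (x : ((O j).cx n).X p) :
      SumRel n p' (sumTerm O j (((O j).cx n).d p p' x)) (.diff h (sumTerm O j x))
  | act (j : J) {n : ℕ} {p : ℤ} (σ : Equiv.Perm (Fin n)) (x : ((O j).cx n).X p) :
      SumRel n p (sumTerm O j (((O j).act σ).f p x)) (.act σ (sumTerm O j x))
  | one (j : J) : SumRel 1 0 (sumTerm O j (O j).one) .one
  | comp (j : J) {m n l : ℕ} (i : Fin m) (e : {x : Fin m // x ≠ i} ⊕ Fin n ≃ Fin l)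
      {p q r : ℤ} (h : p + q = r) (a : ((O j).cx m).X p) (b : ((O j).cx n).X q) :
      SumRel l r (sumTerm O j ((O j).comp i e h a b)) (.comp i e h (sumTerm O j a) (sumTerm O j b))

/-- The coproduct of a family of operads. -/
def sumOperad : DGOperad k := presentedOperad (SumRel O)

namespace sumOperad

/-- The canonical morphisms to the coproduct. -/
def ι (j : J) : O j ⟶ sumOperad O :=
  DGOperad.Hom.mk
    (fun n =>
      { f := fun p => ModuleCat.ofHom
          { toFun := fun x => OpQuot.mk (sumTerm O j x)
            map_add' := fun x y => OpQuot.sound (.rel (.add j x y))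
            map_smul' := fun c x => OpQuot.sound (.rel (.smul j c x)) }
        comm' := fun p p' h => by
          ext x
          exact (OpQuot.cx_d_apply (n := n) h _).trans (OpQuot.sound (.rel (.diff j h x))).symm })
    (fun σ => by
      ext p x
      exact OpQuot.sound (.rel (.act j σ x)))
    (OpQuot.sound (.rel (.one j)))
    (fun i e _ _ _ h a b => OpQuot.sound (.rel (.comp j i e h a b)))

/-- The morphism from the coproduct determined by morphisms from the members. -/
def desc {P : DGOperad k} (f : ∀ j, O j ⟶ P) : sumOperad O ⟶ P :=
  presentedOperad.desc P (fun n p x => ((f x.1).app n).f p x.2)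
    (fun _ _ s t h => by
      cases h with
      | add j x y => exact map_add _ _ _
      | smul j c x => exact (ModuleCat.Hom.hom _).map_smul _ _
      | diff j h x =>
        simp only [OpTerm.value, sumTerm]
        rw [← ConcreteCategory.comp_apply, ← ConcreteCategory.comp_apply,
          HomologicalComplex.Hom.comm]
      | act j σ x =>
        simp only [OpTerm.value, sumTerm]
        rw [← ConcreteCategory.comp_apply, ← ConcreteCategory.comp_apply,
          ← HomologicalComplex.comp_f, ← HomologicalComplex.comp_f, (f j).map_act]
      | one j => exact (f j).map_one
      | comp j i e h a b => exact (f j).map_comp _ _ _ _ _)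

/-- The universal property of the coproduct. -/
def isColimit : IsColimit (Cofan.mk (sumOperad O) (ι O)) :=
  Cofan.IsColimit.mk _ (fun s => desc O s.inj)
    (fun s j => by
      ext n p x
      rfl)
    (fun s m hm => by
      refine presentedOperad.hom_ext_gen fun n p x => ?_
      obtain ⟨j, x⟩ := x
      have := hm j
      exact congrArg (fun f : O j ⟶ s.pt => (f.app n).f p x) this)

end sumOperad

end Coproducts

instance (k : Type u) [CommRing k] (J : Type) :
    HasColimitsOfShape (Discrete J) (DGOperad.{u} k) where
  has_colimit F := by
    have : HasColimit (Discrete.functor (F.obj ∘ Discrete.mk)) :=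
      ⟨⟨⟨_, sumOperad.isColimit (F.obj ∘ Discrete.mk)⟩⟩⟩
    exact hasColimit_of_iso Discrete.natIsoFunctor

instance (k : Type u) [CommRing k] : HasBinaryCoproducts (DGOperad.{u} k) :=
  inferInstanceAs (HasColimitsOfShape (Discrete WalkingPair) (DGOperad.{u} k))

/-- The shifted cone `cone(id_k)[s]`, where `k` is seen as a complex concentrated in degree zero. -/
noncomputable def shiftedCone (k : Type u) [CommRing k] (s : ℤ) :
    CochainComplex (ModuleCat.{u} k) ℤ :=
  (CochainComplex.mappingCone
    (𝟙 ((CochainComplex.singleFunctor (ModuleCat.{u} k) 0).obj (ModuleCat.of k k))))⟦s⟧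

/-!
Write `P` for `O ⨿ F(M, n)`, where `M` is contractible with contracting homotopy `s`. Let `ρ` be the
endomorphism of `P` that is the identity on `O` and kills `M`; it factors through a retraction of
`P` onto `O`, so it suffices that `ρ` is the identity on homology. The homotopies that show this are
all obtained from the universal property of `P`, by mapping it to an operad `Q` built from `P` such
that a morphism `P ⟶ Q` over `P` is a family of maps and homotopies compatible with composition.
No description of `P` by trees is needed.

*Rational coefficients.* For `Q = derivationOperad P`, the morphism amounts to a derivation `h` of
degree `-1` with `h = 0` on `O` and `h = s` on `M`, together with `D = d h + h d`, which is a
derivation with `D = 0` on `O` and `D = 1` on `M`. So `D` multiplies an operation with `w`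
occurrences of elements of `M` by `w`, and `D` is zero on homology. For `N` large compared to the
weights that occur in a given operation `x`, the product of the operators `1 - D / w` for
`1 ≤ w ≤ N` sends `x` to `ρ x`, and it is the identity on homology
(`DGOperad.quasiIso_inl_of_rat`).

*No operations of arity zero.* Over a general ring one has to single out one element of `M` at a
time. The vertices on the path from the root of a tree to the input `j` are totally ordered. For
`Q = pathOperad P`, the morphism amounts to the endomorphisms `f j` of the complexes `P(r)`, for
inputs `j`, that kill the elements of `M` along the path to `j`, with homotopies from the identity
to `f j` that apply `s` to one element on the path after killing those nearer to the root. If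
`O(0) = 0` and `n > 0`, then every vertex lies on the path to some input, so the composite of the
`f j` over all inputs is `ρ` (`DGOperad.pathListMap_eq_projection`), and it is the identity on
homology (`DGOperad.quasiIso_inl_of_isZero`).
-/

/-! ### Complexes of chain homotopies -/

namespace CochainComplex

variable {k : Type u} [CommRing k] (K : CochainComplex (ModuleCat.{u} k) ℤ)

/-- The identification of the components of a complex in two equal degrees. -/
def castX {p q : ℤ} (h : p = q) : K.X p →ₗ[k] K.X q :=
  (K.XIsoOfEq h).hom.hom

@[simp]
theorem castX_rfl {p : ℤ} (x : K.X p) : K.castX rfl x = x := by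
  simp [castX]

@[simp]
theorem castX_castX {p q r : ℤ} (h : p = q) (h' : q = r) (x : K.X p) :
    K.castX h' (K.castX h x) = K.castX (h.trans h') x := by
  subst h h'
  simp

theorem d_castX {p q : ℤ} (h : p = q) {r : ℤ} (x : K.X p) :
    K.d q r (K.castX h x) = K.d p r x := by
  subst h
  simp

theorem castX_d {p q : ℤ} (h : p = q) {r : ℤ} (x : K.X r) :
    K.castX h (K.d r p x) = K.d r q x := by
  subst h
  simp

variable {K} in
theorem map_castX {L : CochainComplex (ModuleCat.{u} k) ℤ} (f : K ⟶ L) {p q : ℤ} (h : p = q)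
    (x : K.X p) : f.f q (K.castX h x) = L.castX h (f.f p x) := by
  subst h
  simp

theorem d_d_apply {p q r : ℤ} (x : K.X p) : K.d q r (K.d p q x) = 0 := by
  rw [← ConcreteCategory.comp_apply, HomologicalComplex.d_comp_d]
  rfl

variable {K} in
theorem map_d {L : CochainComplex (ModuleCat.{u} k) ℤ} (f : K ⟶ L) {p q : ℤ}
    (x : K.X p) : f.f q (K.d p q x) = L.d p q (f.f p x) := by
  rw [← ConcreteCategory.comp_apply, ← ConcreteCategory.comp_apply, HomologicalComplex.Hom.comm]

/-- The differential of `homotopyComplex`, see there. -/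
def homotopyDiff (ε δ : k) (J : Type) {p p' : ℤ} (h : p + 1 = p') :
    (K.X p × (J → K.X p) × (J → K.X (p - 1))) →ₗ[k]
      (K.X p' × (J → K.X p') × (J → K.X (p' - 1))) where
  toFun x := (K.d p p' x.1, fun j => K.d p p' (x.2.1 j), fun j =>
    K.castX (eq_sub_of_add_eq h) (ε • x.1 + δ • x.2.1 j) - K.d (p - 1) (p' - 1) (x.2.2 j))
  map_add' x y := by
    ext j
    · simp
    · simp
    · simp only [Prod.fst_add, Prod.snd_add, Pi.add_apply, map_add, smul_add]
      abel
  map_smul' c x := by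
    ext j
    · simp
    · simp
    · simp only [Prod.smul_fst, Prod.smul_snd, Pi.smul_apply, map_smul, map_add,
        RingHom.id_apply, smul_sub, smul_add, smul_comm c]

/-- The complex whose elements are triples `(x, y, z)`, with `x` in `K` and families `y` in `K` and
`z` in `K[-1]` indexed by `J`, and with differential
`d (x, y, z) = (d x, d y, ε x + δ y - d z)`.
A morphism `L ⟶ homotopyComplex K ε δ J` is a morphism `a : L ⟶ K` with families of morphisms
`f j : L ⟶ K` and of homotopies `h j` such that `d (h j) + (h j) d = ε a + δ (f j)`. -/
def homotopyComplex (ε δ : k) (J : Type) : CochainComplex (ModuleCat.{u} k) ℤ where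
  X p := ModuleCat.of k (K.X p × (J → K.X p) × (J → K.X (p - 1)))
  d p p' := if h : p + 1 = p' then ModuleCat.ofHom (K.homotopyDiff ε δ J h) else 0
  shape p p' h := dif_neg h
  d_comp_d' p p' p'' h h' := by
    have h1 : p + 1 = p' := h
    have h2 : p' + 1 = p'' := h'
    rw [dif_pos h1, dif_pos h2, ← ModuleCat.ofHom_comp]
    refine ModuleCat.hom_ext (LinearMap.ext fun x => ?_)
    refine Prod.ext ?_ (Prod.ext (funext fun j => ?_) (funext fun j => ?_))
    · exact d_d_apply _ _
    · exact d_d_apply _ _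
    · simp [homotopyDiff, d_d_apply, d_castX, castX_d]

theorem homotopyComplex_d_apply (ε δ : k) (J : Type) {p p' : ℤ} (h : p + 1 = p')
    (x : (K.homotopyComplex ε δ J).X p) :
    (K.homotopyComplex ε δ J).d p p' x = K.homotopyDiff ε δ J h x := by
  have : (K.homotopyComplex ε δ J).d p p' = ModuleCat.ofHom (K.homotopyDiff ε δ J h) := dif_pos h
  rw [this]
  rfl

variable {K} {L : CochainComplex (ModuleCat.{u} k) ℤ} {ε δ : k} {J : Type}

/-- The morphism to `homotopyComplex` given by a morphism, a family of morphisms, and a family of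
homotopies. -/
def homotopyLift (a : L ⟶ K) (f : J → (L ⟶ K)) (h : J → ∀ p, L.X p →ₗ[k] K.X (p - 1))
    (H : ∀ j p p' (hp : p + 1 = p') (x : L.X p),
      K.castX (eq_sub_of_add_eq hp) (ε • a.f p x + δ • (f j).f p x) - K.d (p - 1) (p' - 1) (h j p x)
        = h j p' (L.d p p' x)) :
    L ⟶ K.homotopyComplex ε δ J where
  f p := ModuleCat.ofHom
    { toFun := fun x => (a.f p x, fun j => (f j).f p x, fun j => h j p x)
      map_add' := fun x y => by ext <;> simp
      map_smul' := fun c x => by ext <;> simp }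
  comm' p p' hp := by
    have h1 : p + 1 = p' := hp
    ext x
    refine (K.homotopyComplex_d_apply ε δ J h1 _).trans ?_
    refine Prod.ext ?_ (Prod.ext (funext fun j => ?_) (funext fun j => ?_))
    · exact (map_d a x).symm
    · exact (map_d (f j) x).symm
    · exact H j p p' h1 x

theorem homotopyComplex_ext {p : ℤ} {x y : (K.homotopyComplex ε δ J).X p} (h₁ : x.1 = y.1)
    (h₂ : ∀ j, x.2.1 j = y.2.1 j) (h₃ : ∀ j, x.2.2 j = y.2.2 j) : x = y :=
  Prod.ext h₁ (Prod.ext (funext h₂) (funext h₃))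

/-- The components of `homotopyMap`, see there. -/
def homotopyMapX (g : L ⟶ K) {J' : Type} (t : J' → J) (p : ℤ) :
    (L.X p × (J → L.X p) × (J → L.X (p - 1))) →ₗ[k]
      (K.X p × (J' → K.X p) × (J' → K.X (p - 1))) where
  toFun x := (g.f p x.1, fun j => g.f p (x.2.1 (t j)), fun j => g.f _ (x.2.2 (t j)))
  map_add' x y := by ext <;> simp
  map_smul' c x := by ext <;> simp

/-- The functoriality of `homotopyComplex` in the complex and in the index type. -/
def homotopyMap (g : L ⟶ K) {J' : Type} (t : J' → J) :
    L.homotopyComplex ε δ J ⟶ K.homotopyComplex ε δ J' where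
  f p := ModuleCat.ofHom (homotopyMapX g t p)
  comm' p p' hp := by
    have h1 : p + 1 = p' := hp
    ext x
    refine (K.homotopyComplex_d_apply ε δ J' h1 _).trans (.trans ?_
      (congrArg (homotopyMapX g t p') (L.homotopyComplex_d_apply ε δ J h1 x)).symm)
    refine homotopyComplex_ext (ε := ε) (δ := δ) ?_ (fun j => ?_) (fun j => ?_)
    · exact (map_d g _).symm
    · exact (map_d g _).symm
    · simp [homotopyDiff, homotopyMapX, map_castX, map_d]
      rfl

section Components

variable (φ : L ⟶ K.homotopyComplex ε δ J)

theorem map_d_of_homotopyComplex {p p' : ℤ} (h : p + 1 = p') (x : L.X p) :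
    φ.f p' (L.d p p' x) = K.homotopyDiff ε δ J h (φ.f p x) :=
  (map_d φ x).trans (homotopyComplex_d_apply _ _ _ _ h _)

/-- The morphism in the first component of a morphism to `homotopyComplex`. -/
def homotopyFst : L ⟶ K where
  f p := ModuleCat.ofHom ((LinearMap.fst k _ _).comp (φ.f p).hom)
  comm' p p' h := by
    ext x
    exact (congrArg Prod.fst (map_d_of_homotopyComplex φ h x)).symm

/-- The morphisms in the second component of a morphism to `homotopyComplex`. -/
def homotopySnd (j : J) : L ⟶ K where
  f p := ModuleCat.ofHom
    ((LinearMap.proj j).comp ((LinearMap.fst k _ _).comp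
      ((LinearMap.snd k _ _).comp (φ.f p).hom)))
  comm' p p' h := by
    ext x
    exact (congrFun (congrArg (fun y => y.2.1) (map_d_of_homotopyComplex φ h x)) j).symm

/-- The homotopy in the third component of a morphism to `homotopyComplex`. -/
noncomputable def homotopyThd (j : J) : Homotopy (ε • homotopyFst φ + δ • homotopySnd φ j) 0 where
  hom p q := if h : q + 1 = p then ModuleCat.ofHom
      ((K.castX (sub_eq_of_eq_add h.symm)).comp ((LinearMap.proj j).comp ((LinearMap.snd k _ _).comp
        ((LinearMap.snd k _ _).comp (φ.f p).hom)))) else 0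
  zero p q h := dif_neg h
  comm p := by
    rw [dNext_eq _ (show (ComplexShape.up ℤ).Rel p (p + 1) from rfl),
      prevD_eq _ (show (ComplexShape.up ℤ).Rel (p - 1) p from sub_add_cancel p 1),
      dif_pos rfl, dif_pos (sub_add_cancel p 1)]
    ext x
    have h1 := congrFun (congrArg (fun y => y.2.2) (map_d_of_homotopyComplex φ rfl x)) j
    have h2 := congrArg (K.castX (add_sub_cancel_right p 1)) h1
    simp only [homotopyDiff, LinearMap.coe_mk, AddHom.coe_mk, map_sub, castX_castX, castX_rfl,
      castX_d] at h2
    have e1 : ∀ y : K.X (p - 1), K.castX (sub_eq_of_eq_add (sub_add_cancel p 1).symm) y = y :=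
      fun y => castX_rfl _ y
    simp only [HomologicalComplex.zero_f, add_zero]
    exact (sub_add_cancel _ _).symm.trans
      (congrArg₂ (· + ·) h2.symm (congrArg (K.d (p - 1) p) (e1 _).symm))

end Components

end CochainComplex

/-! ### Endomorphisms that are the identity on homology -/

namespace HomologicalComplex

variable {k : Type u} [CommRing k] {K L : CochainComplex (ModuleCat.{u} k) ℤ}

/-- If every element of `K` has the same image under `g` as under an endomorphism that is the
identity on homology, then `g` is the identity on homology; the endomorphism may depend on the
element. -/
theorem homologyMap_eq_id_of_locally (g : K ⟶ K)
    (h : ∀ p (x : K.X p), ∃ e : K ⟶ K, (∀ q, homologyMap e q = 𝟙 _) ∧ e.f p x = g.f p x) (p : ℤ) :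
    homologyMap g p = 𝟙 _ := by
  ext y
  obtain ⟨z, rfl⟩ := (ModuleCat.epi_iff_surjective (K.homologyπ p)).1 inferInstance y
  obtain ⟨e, he, hx⟩ := h p (K.iCycles p z)
  have key : cyclesMap e p z = cyclesMap g p z := by
    apply (ModuleCat.mono_iff_injective (K.iCycles p)).1 inferInstance
    rw [← ConcreteCategory.comp_apply, ← ConcreteCategory.comp_apply, cyclesMap_i, cyclesMap_i]
    exact hx
  rw [← ConcreteCategory.comp_apply, homologyπ_naturality, ConcreteCategory.comp_apply, ← key,
    ← ConcreteCategory.comp_apply, ← homologyπ_naturality, he]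
  simp

theorem quasiIso_of_retraction (i : L ⟶ K) (r : K ⟶ L) (hi : i ≫ r = 𝟙 L)
    (h : ∀ p, homologyMap (r ≫ i) p = 𝟙 _) : QuasiIso i where
  quasiIsoAt p := by
    rw [quasiIsoAt_iff_isIso_homologyMap]
    exact ⟨homologyMap r p, by rw [← homologyMap_comp, hi, homologyMap_id],
      by rw [← homologyMap_comp, h]⟩

end HomologicalComplex

/-! ### Identities for partial compositions -/

namespace DGOperad

variable {k : Type u} [CommRing k] (P : DGOperad k)

section Identities

variable {m n l : ℕ} (i : Fin m) (e : {x : Fin m // x ≠ i} ⊕ Fin n ≃ Fin l)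

theorem comp_add_left {p q r : ℤ} (h : p + q = r) (a a' : (P.cx m).X p) (b : (P.cx n).X q) :
    P.comp i e h (a + a') b = P.comp i e h a b + P.comp i e h a' b := by simp

theorem comp_add_right {p q r : ℤ} (h : p + q = r) (a : (P.cx m).X p) (b b' : (P.cx n).X q) :
    P.comp i e h a (b + b') = P.comp i e h a b + P.comp i e h a b' := by simp

theorem comp_smul_left {p q r : ℤ} (h : p + q = r) (c : k) (a : (P.cx m).X p)
    (b : (P.cx n).X q) : P.comp i e h (c • a) b = c • P.comp i e h a b := by simp

theorem comp_smul_right {p q r : ℤ} (h : p + q = r) (c : k) (a : (P.cx m).X p)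
    (b : (P.cx n).X q) : P.comp i e h a (c • b) = c • P.comp i e h a b := by simp

theorem comp_units_smul_left {p q r : ℤ} (h : p + q = r) (c : ℤˣ) (a : (P.cx m).X p)
    (b : (P.cx n).X q) : P.comp i e h (c • a) b = c • P.comp i e h a b := by
  simp [Units.smul_def]

theorem comp_units_smul_right {p q r : ℤ} (h : p + q = r) (c : ℤˣ) (a : (P.cx m).X p)
    (b : (P.cx n).X q) : P.comp i e h a (c • b) = c • P.comp i e h a b := by
  simp [Units.smul_def]

theorem comp_sub_left {p q r : ℤ} (h : p + q = r) (a a' : (P.cx m).X p) (b : (P.cx n).X q) :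
    P.comp i e h (a - a') b = P.comp i e h a b - P.comp i e h a' b := by simp

theorem comp_sub_right {p q r : ℤ} (h : p + q = r) (a : (P.cx m).X p) (b b' : (P.cx n).X q) :
    P.comp i e h a (b - b') = P.comp i e h a b - P.comp i e h a b' := by simp

theorem d_add {p q : ℤ} (a b : (P.cx n).X p) :
    (P.cx n).d p q (a + b) = (P.cx n).d p q a + (P.cx n).d p q b := map_add _ _ _

theorem d_units_smul {p q : ℤ} (c : ℤˣ) (a : (P.cx n).X p) :
    (P.cx n).d p q (c • a) = c • (P.cx n).d p q a := by
  simp [Units.smul_def]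

theorem castX_comp {p q r r' : ℤ} (h : p + q = r) (hr : r = r') (a : (P.cx m).X p)
    (b : (P.cx n).X q) :
    (P.cx l).castX hr (P.comp i e h a b) = P.comp i e (h.trans hr) a b := by
  subst hr
  simp

theorem comp_castX_left {p p' q r : ℤ} (hp : p = p') (h : p' + q = r) (a : (P.cx m).X p)
    (b : (P.cx n).X q) :
    P.comp i e h ((P.cx m).castX hp a) b = P.comp i e (by rw [hp, h]) a b := by
  subst hp
  simp

theorem comp_castX_right {p q q' r : ℤ} (hq : q = q') (h : p + q' = r) (a : (P.cx m).X p)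
    (b : (P.cx n).X q) :
    P.comp i e h a ((P.cx n).castX hq b) = P.comp i e (by rw [hq, h]) a b := by
  subst hq
  simp

end Identities

/-- The sign of `parallel` when the operation inserted first has its degree lowered by one, combined
with the signs of the homotopy passing the operations to its left. -/
theorem negOnePow_parallel_left {α β γ ε : ℤ} (h : α + γ = ε) :
    α.negOnePow * ((β - 1) * γ).negOnePow = (β * γ).negOnePow * ε.negOnePow := by
  rw [← h, sub_mul, one_mul, Int.negOnePow_sub, Int.negOnePow_add, mul_left_comm]

/-- The sign of `parallel` when the operation inserted second has its degree lowered by one,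
combined with the signs of the homotopy passing the operations to its left. -/
theorem negOnePow_parallel_right {α β γ δ : ℤ} (h : α + β = δ) :
    δ.negOnePow * (β * (γ - 1)).negOnePow = (β * γ).negOnePow * α.negOnePow := by
  rw [← h, mul_sub, mul_one, Int.negOnePow_sub, Int.negOnePow_add, mul_mul_mul_comm, mul_comm,
    mul_assoc, mul_left_comm β.negOnePow, ← mul_assoc β.negOnePow, Int.units_mul_self, one_mul,
    mul_comm]

theorem act_one_apply {n : ℕ} {p : ℤ} (a : (P.cx n).X p) : (P.act 1).f p a = a := by
  rw [P.act_one]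
  rfl

theorem act_act {n : ℕ} (σ τ : Equiv.Perm (Fin n)) {p : ℤ} (a : (P.cx n).X p) :
    (P.act σ).f p ((P.act τ).f p a) = (P.act (σ * τ)).f p a := by
  rw [P.act_mul]
  rfl

theorem Hom.map_act_apply {P Q : DGOperad k} (f : P ⟶ Q) {n : ℕ} (σ : Equiv.Perm (Fin n)) {p : ℤ}
    (a : (P.cx n).X p) : (f.app n).f p ((P.act σ).f p a) = (Q.act σ).f p ((f.app n).f p a) :=
  congrArg (fun g => g.f p a) (f.map_act σ)

/-! ### Induction on the elements of a coproduct with a free operad -/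

/-- A family of predicates on the operations of `P` that is stable under all the operations that
build formal operadic expressions. -/
structure IsClosedPred (S : ∀ n p, (P.cx n).X p → Prop) : Prop where
  zero (n p) : S n p 0
  add {n p} {a b : (P.cx n).X p} : S n p a → S n p b → S n p (a + b)
  smul {n p} (c : k) {a : (P.cx n).X p} : S n p a → S n p (c • a)
  diff {n p p'} (h : p + 1 = p') {a : (P.cx n).X p} : S n p a → S n p' ((P.cx n).d p p' a)
  act {n p} (σ : Equiv.Perm (Fin n)) {a : (P.cx n).X p} : S n p a → S n p ((P.act σ).f p a)
  one : S 1 0 P.one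
  comp {m n l : ℕ} (i : Fin m) (e : {x : Fin m // x ≠ i} ⊕ Fin n ≃ Fin l)
    {p q r : ℤ} (h : p + q = r) {a : (P.cx m).X p} {b : (P.cx n).X q} :
    S m p a → S n q b → S l r (P.comp i e h a b)

variable {P}

theorem IsClosedPred.value {S : ∀ n p, (P.cx n).X p → Prop} (hS : P.IsClosedPred S)
    {G : ℕ → ℤ → Type u} (φ : ∀ n p, G n p → (P.cx n).X p) (hφ : ∀ n p x, S n p (φ n p x))
    {n : ℕ} {p : ℤ} (t : OpTerm k G n p) : S n p (t.value P φ) := by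
  induction t with
  | gen x => exact hφ _ _ x
  | zero => exact hS.zero _ _
  | add _ _ hs ht => exact hS.add hs ht
  | smul c _ ht => exact hS.smul c ht
  | diff h _ ht => exact hS.diff h ht
  | act σ _ ht => exact hS.act σ ht
  | one => exact hS.one
  | comp i e h _ _ hs ht => exact hS.comp i e h hs ht

/-- A closed predicate holds on the image of a presented operad if it holds on the images of the
generators. -/
theorem IsClosedPred.presented {S : ∀ n p, (P.cx n).X p → Prop} (hS : P.IsClosedPred S)
    {G : ℕ → ℤ → Type u} {R : ∀ n p, OpTerm k G n p → OpTerm k G n p → Prop}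
    (f : presentedOperad R ⟶ P)
    (hG : ∀ n p (x : G n p), S n p ((f.app n).f p (presentedOperad.gen x)))
    {n : ℕ} {p : ℤ} (z : ((presentedOperad R).cx n).X p) : S n p ((f.app n).f p z) := by
  induction z using OpQuot.ind with
  | h t =>
    rw [← presentedOperad.value_gen, presentedOperad.map_value]
    exact hS.value _ hG t

/-- The canonical morphism from `M` to the `n`-ary operations of the coproduct `O ⨿ F(M, n)`. -/
noncomputable abbrev coprodGen (O : DGOperad k) (M : CochainComplex (ModuleCat.{u} k) ℤ) (n : ℕ) :
    M ⟶ (O ⨿ freeOperad M n).cx n :=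
  freeOperad.incl M n ≫ Hom.app (coprod.inr : _ ⟶ O ⨿ freeOperad M n) n

/-- A closed predicate on `O ⨿ F(M, n)` that holds on the images of `O` and of `M` holds
everywhere. -/
theorem IsClosedPred.coprod {O : DGOperad k} {M : CochainComplex (ModuleCat.{u} k) ℤ} {n : ℕ}
    {S : ∀ m p, ((O ⨿ freeOperad M n).cx m).X p → Prop}
    (hS : (O ⨿ freeOperad M n).IsClosedPred S)
    (hO : ∀ m p (x : (O.cx m).X p),
      S m p ((Hom.app (coprod.inl : O ⟶ O ⨿ freeOperad M n) m).f p x))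
    (hM : ∀ p (x : M.X p), S n p ((coprodGen O M n).f p x))
    {m : ℕ} {p : ℤ} (z : ((O ⨿ freeOperad M n).cx m).X p) : S m p z := by
  -- The concrete coproduct of the family maps onto the chosen coproduct.
  let fam : WalkingPair → DGOperad k := fun j => WalkingPair.casesOn j O (freeOperad M n)
  let t : sumOperad fam ⟶ O ⨿ freeOperad M n :=
    sumOperad.desc fam fun j => match j with
      | .left => coprod.inl
      | .right => coprod.inr
  let s : O ⨿ freeOperad M n ⟶ sumOperad fam :=
    coprod.desc (sumOperad.ι fam .left) (sumOperad.ι fam .right)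
  have hst : s ≫ t = 𝟙 _ := by
    refine coprod.hom_ext ?_ ?_
    · rw [coprod.inl_desc_assoc, Category.comp_id]
      rfl
    · rw [coprod.inr_desc_assoc, Category.comp_id]
      rfl
  have hz : z = (t.app m).f p ((s.app m).f p z) :=
    (congrArg (fun f : O ⨿ freeOperad M n ⟶ O ⨿ freeOperad M n => (f.app m).f p z) hst).symm
  rw [hz]
  refine hS.presented t (fun m p x => ?_) _
  obtain ⟨j, x⟩ := x
  cases j with
  | left => exact hO m p x
  | right =>
    refine hS.presented (coprod.inr : freeOperad M n ⟶ O ⨿ freeOperad M n) (fun m p y => ?_) x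
    cases y with
    | mk y => exact hM _ y

theorem coprodGen_desc {O Q : DGOperad k} {M : CochainComplex (ModuleCat.{u} k) ℤ} {n : ℕ}
    (f : O ⟶ Q) (g : M ⟶ Q.cx n) :
    coprodGen O M n ≫ Hom.app (coprod.desc f (freeOperad.lift g)) n = g := by
  rw [Category.assoc, ← comp_app, coprod.inr_desc]
  exact (freeOperad.homEquiv Q).right_inv g

theorem coprod_free_hom_ext {O Q : DGOperad k} {M : CochainComplex (ModuleCat.{u} k) ℤ} {n : ℕ}
    {f g : O ⨿ freeOperad M n ⟶ Q} (hO : (coprod.inl : O ⟶ _) ≫ f = coprod.inl ≫ g)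
    (hM : coprodGen O M n ≫ f.app n = coprodGen O M n ≫ g.app n) : f = g := by
  refine coprod.hom_ext hO ((freeOperad.homEquiv Q).injective ?_)
  simpa only [coprodGen, Category.assoc] using! hM

end DGOperad

/-! ### The operad classifying derivations of degree `-1` -/

namespace DGOperad

open CochainComplex

variable {k : Type u} [CommRing k] (P : DGOperad k)

/-- Partial composition in `derivationOperad`. -/
def derivationComp {m n l : ℕ} (i : Fin m) (e : {x : Fin m // x ≠ i} ⊕ Fin n ≃ Fin l)
    {p q r : ℤ} (h : p + q = r) :
    ((P.cx m).homotopyComplex 0 1 Unit).X p →ₗ[k] ((P.cx n).homotopyComplex 0 1 Unit).X q →ₗ[k]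
      ((P.cx l).homotopyComplex 0 1 Unit).X r :=
  LinearMap.mk₂ k
    (fun x y => (P.comp i e h x.1 y.1,
      fun j => P.comp i e h (x.2.1 j) y.1 + P.comp i e h x.1 (y.2.1 j),
      fun j => P.comp i e (by lia) (x.2.2 j) y.1 +
        p.negOnePow • P.comp i e (by lia) x.1 (y.2.2 j)))
    (fun x x' y => by
      refine homotopyComplex_ext ?_ (fun j => ?_) (fun j => ?_)
      · exact P.comp_add_left i e _ _ _ _
      · change P.comp i e h (x.2.1 j + x'.2.1 j) y.1 + P.comp i e h (x.1 + x'.1) (y.2.1 j) =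
          (P.comp i e h (x.2.1 j) y.1 + P.comp i e h x.1 (y.2.1 j)) +
            (P.comp i e h (x'.2.1 j) y.1 + P.comp i e h x'.1 (y.2.1 j))
        rw [comp_add_left, comp_add_left]
        abel
      · change P.comp i e _ (x.2.2 j + x'.2.2 j) y.1 +
            p.negOnePow • P.comp i e _ (x.1 + x'.1) (y.2.2 j) =
          (P.comp i e _ (x.2.2 j) y.1 + p.negOnePow • P.comp i e _ x.1 (y.2.2 j)) +
            (P.comp i e _ (x'.2.2 j) y.1 + p.negOnePow • P.comp i e _ x'.1 (y.2.2 j))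
        rw [comp_add_left, comp_add_left, smul_add]
        abel)
    (fun c x y => by
      refine homotopyComplex_ext ?_ (fun j => ?_) (fun j => ?_)
      · exact P.comp_smul_left i e _ _ _ _
      · change P.comp i e h (c • x.2.1 j) y.1 + P.comp i e h (c • x.1) (y.2.1 j) =
          c • (P.comp i e h (x.2.1 j) y.1 + P.comp i e h x.1 (y.2.1 j))
        rw [comp_smul_left, comp_smul_left, smul_add]
      · change P.comp i e _ (c • x.2.2 j) y.1 +
            p.negOnePow • P.comp i e _ (c • x.1) (y.2.2 j) =
          c • (P.comp i e _ (x.2.2 j) y.1 + p.negOnePow • P.comp i e _ x.1 (y.2.2 j))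
        rw [comp_smul_left, comp_smul_left, smul_add, smul_comm c])
    (fun x y y' => by
      refine homotopyComplex_ext ?_ (fun j => ?_) (fun j => ?_)
      · exact P.comp_add_right i e _ _ _ _
      · change P.comp i e h (x.2.1 j) (y.1 + y'.1) + P.comp i e h x.1 (y.2.1 j + y'.2.1 j) =
          (P.comp i e h (x.2.1 j) y.1 + P.comp i e h x.1 (y.2.1 j)) +
            (P.comp i e h (x.2.1 j) y'.1 + P.comp i e h x.1 (y'.2.1 j))
        rw [comp_add_right, comp_add_right]
        abel
      · change P.comp i e _ (x.2.2 j) (y.1 + y'.1) +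
            p.negOnePow • P.comp i e _ x.1 (y.2.2 j + y'.2.2 j) =
          (P.comp i e _ (x.2.2 j) y.1 + p.negOnePow • P.comp i e _ x.1 (y.2.2 j)) +
            (P.comp i e _ (x.2.2 j) y'.1 + p.negOnePow • P.comp i e _ x.1 (y'.2.2 j))
        rw [comp_add_right, comp_add_right, smul_add]
        abel)
    (fun c x y => by
      refine homotopyComplex_ext ?_ (fun j => ?_) (fun j => ?_)
      · exact P.comp_smul_right i e _ _ _ _
      · change P.comp i e h (x.2.1 j) (c • y.1) + P.comp i e h x.1 (c • y.2.1 j) =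
          c • (P.comp i e h (x.2.1 j) y.1 + P.comp i e h x.1 (y.2.1 j))
        rw [comp_smul_right, comp_smul_right, smul_add]
      · change P.comp i e _ (x.2.2 j) (c • y.1) +
            p.negOnePow • P.comp i e _ x.1 (c • y.2.2 j) =
          c • (P.comp i e _ (x.2.2 j) y.1 + p.negOnePow • P.comp i e _ x.1 (y.2.2 j))
        rw [comp_smul_right, comp_smul_right, smul_add, smul_comm c])

/-- The operad of triples `(a, b, c)` of operations of `P`, with `c` of degree one less than `a` and
`b`, composed like `a + η b + θ c`, where `η` has degree `0`, `θ = d η` has degree `1`, and all products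
of `η` and `θ` vanish. Writing a morphism `O ⟶ derivationOperad P` as `(f, D, h)`, the map `h` is a derivation
of degree `-1` along `f`, and `D = d h + h d`. -/
def derivationOperad : DGOperad k where
  cx n := (P.cx n).homotopyComplex 0 1 Unit
  act σ := homotopyMap (P.act σ) id
  act_one n := by
    ext p x
    exact homotopyComplex_ext (P.act_one_apply _) (fun _ => P.act_one_apply _)
      (fun _ => P.act_one_apply _)
  act_mul σ τ := by
    ext p x
    exact homotopyComplex_ext (P.act_act _ _ _).symm (fun _ => (P.act_act _ _ _).symm)
      (fun _ => (P.act_act _ _ _).symm)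
  one := (P.one, 0, 0)
  d_one := by
    refine (homotopyComplex_d_apply _ _ _ _ (zero_add 1) _).trans ?_
    refine homotopyComplex_ext ?_ (fun j => ?_) (fun j => ?_)
    · exact P.d_one
    · exact map_zero _
    · simp [homotopyDiff]
      rfl
  comp i e _ _ _ h := P.derivationComp i e h
  d_comp i e p q r p' q' r' h hp hq hr h₁ h₂ a b := by
    rw [homotopyComplex_d_apply _ _ _ _ hr, homotopyComplex_d_apply _ _ _ _ hp,
      homotopyComplex_d_apply _ _ _ _ hq]
    have hp' : p'.negOnePow = -p.negOnePow := by rw [← hp, Int.negOnePow_succ]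
    have hpp : (p - 1).negOnePow = -p.negOnePow := by
      rw [Int.negOnePow_sub, Int.negOnePow_one, mul_neg_one]
    refine homotopyComplex_ext ?_ (fun j => ?_) (fun j => ?_)
    · exact P.d_comp i e h hp hq hr h₁ h₂ _ _
    · change (P.cx _).d r r' (P.comp i e h (a.2.1 j) b.1 + P.comp i e h a.1 (b.2.1 j)) =
        P.comp i e h₁ ((P.cx _).d p p' (a.2.1 j)) b.1 +
          P.comp i e h₁ ((P.cx _).d p p' a.1) (b.2.1 j) +
        p.negOnePow • (P.comp i e h₂ (a.2.1 j) ((P.cx _).d q q' b.1) +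
          P.comp i e h₂ a.1 ((P.cx _).d q q' (b.2.1 j)))
      rw [map_add, P.d_comp i e h hp hq hr h₁ h₂, P.d_comp i e h hp hq hr h₁ h₂, smul_add]
      abel
    · change (P.cx _).castX (eq_sub_of_add_eq hr) ((0 : k) • P.comp i e h a.1 b.1 +
            (1 : k) • (P.comp i e h (a.2.1 j) b.1 + P.comp i e h a.1 (b.2.1 j))) -
          (P.cx _).d (r - 1) (r' - 1) (P.comp i e _ (a.2.2 j) b.1 +
            p.negOnePow • P.comp i e _ a.1 (b.2.2 j)) =
        P.comp i e _ ((P.cx _).castX (eq_sub_of_add_eq hp) ((0 : k) • a.1 + (1 : k) • a.2.1 j) -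
            (P.cx _).d (p - 1) (p' - 1) (a.2.2 j)) b.1 +
          p'.negOnePow • P.comp i e _ ((P.cx _).d p p' a.1) (b.2.2 j) +
        p.negOnePow • (P.comp i e _ (a.2.2 j) ((P.cx _).d q q' b.1) +
          p.negOnePow • P.comp i e _ a.1
            ((P.cx _).castX (eq_sub_of_add_eq hq) ((0 : k) • b.1 + (1 : k) • b.2.1 j) -
              (P.cx _).d (q - 1) (q' - 1) (b.2.2 j)))
      rw [P.d_add, d_units_smul,
        P.d_comp i e (show p - 1 + q = r - 1 by lia) (show p - 1 + 1 = p' - 1 by lia) hq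
          (show r - 1 + 1 = r' - 1 by lia) (show p' - 1 + q = r' - 1 by lia) (by lia),
        P.d_comp i e (show p + (q - 1) = r - 1 by lia) hp (show q - 1 + 1 = q' - 1 by lia)
          (show r - 1 + 1 = r' - 1 by lia) (by lia) (show p + (q' - 1) = r' - 1 by lia), hp', hpp]
      simp only [zero_smul, zero_add, one_smul, map_add, comp_sub_left, comp_sub_right,
        castX_comp, comp_castX_left, comp_castX_right, smul_add, smul_sub, smul_smul,
        Int.units_mul_self, Units.neg_smul]
      abel
  act_comp i e ρ _ _ _ h a b := by
    refine homotopyComplex_ext ?_ (fun j => ?_) (fun j => ?_)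
    · exact P.act_comp _ _ _ _ _ _
    · refine (map_add _ _ _).trans ?_
      erw [P.act_comp, P.act_comp]
      rfl
    · refine (map_add _ _ _).trans ?_
      rw [Units.smul_def, map_zsmul]
      erw [P.act_comp, P.act_comp]
      rfl
  comp_act i σ τ e e' h₁ h₂ _ _ _ h a b := by
    refine homotopyComplex_ext ?_ (fun j => ?_) (fun j => ?_)
    · exact P.comp_act i σ τ e e' h₁ h₂ _ _ _
    · exact congrArg₂ (· + ·) (P.comp_act i σ τ e e' h₁ h₂ _ _ _)
        (P.comp_act i σ τ e e' h₁ h₂ _ _ _)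
    · exact congrArg₂ (fun x y => x + Int.negOnePow _ • y) (P.comp_act i σ τ e e' h₁ h₂ _ _ _)
        (P.comp_act i σ τ e e' h₁ h₂ _ _ _)
  one_comp i e he q b := by
    refine homotopyComplex_ext ?_ (fun j => ?_) (fun j => ?_)
    · exact P.one_comp i e he _
    · change P.comp i e _ 0 b.1 + P.comp i e _ P.one (b.2.1 j) = _
      rw [map_zero, LinearMap.zero_apply, zero_add, P.one_comp i e he]
    · change P.comp i e _ 0 b.1 + Int.negOnePow 0 • P.comp i e _ P.one (b.2.2 j) = _
      rw [map_zero, LinearMap.zero_apply, zero_add, P.one_comp i e he, Int.negOnePow_zero, one_smul]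
  comp_one i e he p a := by
    refine homotopyComplex_ext ?_ (fun j => ?_) (fun j => ?_)
    · exact P.comp_one i e he _
    · change P.comp i e _ (a.2.1 j) P.one + P.comp i e _ a.1 0 = _
      rw [map_zero, add_zero, P.comp_one i e he]
    · change P.comp i e _ (a.2.2 j) P.one + Int.negOnePow p • P.comp i e _ a.1 0 = _
      rw [map_zero, smul_zero, add_zero, P.comp_one i e he]
  assoc i j e f f' e' h₁ h₂ h₃ α β γ δ ε ζ hαβ hδγ hβγ hαε a b c := by
    refine homotopyComplex_ext ?_ (fun t => ?_) (fun t => ?_)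
    · exact P.assoc i j e f f' e' h₁ h₂ h₃ _ _ _ _ _ _ _
    · change P.comp _ f hδγ (P.comp i e hαβ (a.2.1 t) b.1 + P.comp i e hαβ a.1 (b.2.1 t)) c.1 +
          P.comp _ f hδγ (P.comp i e hαβ a.1 b.1) (c.2.1 t) =
        P.comp i e' hαε (a.2.1 t) (P.comp j f' hβγ b.1 c.1) +
          P.comp i e' hαε a.1 (P.comp j f' hβγ (b.2.1 t) c.1 + P.comp j f' hβγ b.1 (c.2.1 t))
      rw [comp_add_left, comp_add_right]
      iterate 3 rw [P.assoc i j e f f' e' h₁ h₂ h₃ hαβ hδγ hβγ hαε]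
      rw [add_assoc]
    · change P.comp _ f _ (P.comp i e _ (a.2.2 t) b.1 +
            α.negOnePow • P.comp i e _ a.1 (b.2.2 t)) c.1 +
          δ.negOnePow • P.comp _ f _ (P.comp i e hαβ a.1 b.1) (c.2.2 t) =
        P.comp i e' _ (a.2.2 t) (P.comp j f' hβγ b.1 c.1) +
          α.negOnePow • P.comp i e' _ a.1 (P.comp j f' _ (b.2.2 t) c.1 +
            β.negOnePow • P.comp j f' _ b.1 (c.2.2 t))
      rw [comp_add_left, comp_add_right, comp_units_smul_left, comp_units_smul_right,
        P.assoc i j e f f' e' h₁ h₂ h₃ _ _ hβγ (by lia),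
        P.assoc i j e f f' e' h₁ h₂ h₃ _ _ (by lia) (show α + (ε - 1) = ζ - 1 by lia),
        P.assoc i j e f f' e' h₁ h₂ h₃ _ _ (by lia) (show α + (ε - 1) = ζ - 1 by lia),
        ← hαβ, Int.negOnePow_add, mul_smul, smul_add, add_assoc]
  parallel i j hji hij e f e' f' h₁ h₂ h₃ α β γ δ ε ζ hαβ hδγ hαγ hεβ a b c := by
    refine homotopyComplex_ext ?_ (fun t => ?_) (fun t => ?_)
    · exact P.parallel i j hji hij e f e' f' h₁ h₂ h₃ _ _ _ _ _ _ _
    · change P.comp _ f hδγ (P.comp i e hαβ (a.2.1 t) b.1 + P.comp i e hαβ a.1 (b.2.1 t)) c.1 +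
          P.comp _ f hδγ (P.comp i e hαβ a.1 b.1) (c.2.1 t) =
        (β * γ).negOnePow • (P.comp _ f' hεβ (P.comp j e' hαγ (a.2.1 t) c.1 +
            P.comp j e' hαγ a.1 (c.2.1 t)) b.1 +
          P.comp _ f' hεβ (P.comp j e' hαγ a.1 c.1) (b.2.1 t))
      rw [comp_add_left, comp_add_left]
      iterate 3 rw [P.parallel i j hji hij e f e' f' h₁ h₂ h₃ hαβ hδγ hαγ hεβ]
      rw [smul_add, smul_add]
      abel
    · change P.comp _ f _ (P.comp i e _ (a.2.2 t) b.1 +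
            α.negOnePow • P.comp i e _ a.1 (b.2.2 t)) c.1 +
          δ.negOnePow • P.comp _ f _ (P.comp i e hαβ a.1 b.1) (c.2.2 t) =
        (β * γ).negOnePow • (P.comp _ f' _ (P.comp j e' _ (a.2.2 t) c.1 +
            α.negOnePow • P.comp j e' _ a.1 (c.2.2 t)) b.1 +
          ε.negOnePow • P.comp _ f' _ (P.comp j e' hαγ a.1 c.1) (b.2.2 t))
      rw [comp_add_left, comp_add_left, comp_units_smul_left, comp_units_smul_left,
        P.parallel i j hji hij e f e' f' h₁ h₂ h₃ _ _ (show α - 1 + γ = ε - 1 by lia) (by lia),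
        P.parallel i j hji hij e f e' f' h₁ h₂ h₃ _ _ hαγ (by lia),
        P.parallel i j hji hij e f e' f' h₁ h₂ h₃ _ _ (show α + (γ - 1) = ε - 1 by lia) (by lia),
        smul_smul, smul_smul, negOnePow_parallel_left hαγ, negOnePow_parallel_right hαβ]
      simp only [smul_add, smul_smul]
      abel

end DGOperad

/-! ### The operad of paths from the root to an input -/

namespace DGOperad

open CochainComplex

variable {k : Type u} [CommRing k] (P : DGOperad k)

section PathComp

variable {m n l : ℕ} (i : Fin m) (e : {x : Fin m // x ≠ i} ⊕ Fin n ≃ Fin l) {p q r : ℤ}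

/-- The triple underlying a partial composition in `pathOperad`. -/
def pathCompFun (h : p + q = r)
    (x : ((P.cx m).homotopyComplex 1 (-1) (Fin m)).X p)
    (y : ((P.cx n).homotopyComplex 1 (-1) (Fin n)).X q) :
    ((P.cx l).homotopyComplex 1 (-1) (Fin l)).X r :=
  (P.comp i e h x.1 y.1,
    fun j => Sum.elim (fun w => P.comp i e h (x.2.1 w.1) y.1)
      (fun w => P.comp i e h (x.2.1 i) (y.2.1 w)) (e.symm j),
    fun j => Sum.elim (fun w => P.comp i e (by lia) (x.2.2 w.1) y.1)
      (fun w => P.comp i e (by lia) (x.2.2 i) y.1 +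
        p.negOnePow • P.comp i e (by lia) (x.2.1 i) (y.2.2 w)) (e.symm j))

variable (h : p + q = r) (x : ((P.cx m).homotopyComplex 1 (-1) (Fin m)).X p)
    (y : ((P.cx n).homotopyComplex 1 (-1) (Fin n)).X q)

theorem pathCompFun_snd_inl (w : Fin m) (hw : w ≠ i) :
    (P.pathCompFun i e h x y).2.1 (e (.inl ⟨w, hw⟩)) = P.comp i e h (x.2.1 w) y.1 := by
  simp [pathCompFun]

theorem pathCompFun_snd_inr (w : Fin n) :
    (P.pathCompFun i e h x y).2.1 (e (.inr w)) = P.comp i e h (x.2.1 i) (y.2.1 w) := by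
  simp [pathCompFun]

theorem pathCompFun_thd_inl (w : Fin m) (hw : w ≠ i) :
    (P.pathCompFun i e h x y).2.2 (e (.inl ⟨w, hw⟩)) = P.comp i e (by lia) (x.2.2 w) y.1 := by
  simp [pathCompFun]

theorem pathCompFun_thd_inr (w : Fin n) :
    (P.pathCompFun i e h x y).2.2 (e (.inr w)) = P.comp i e (by lia) (x.2.2 i) y.1 +
        p.negOnePow • P.comp i e (by lia) (x.2.1 i) (y.2.2 w) := by
  simp [pathCompFun]

variable {P} in
/-- Two triples of arity `l` are equal if they agree at the inputs that come from either operation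
of a partial composition. -/
theorem path_ext {z z' : ((P.cx l).homotopyComplex 1 (-1) (Fin l)).X r} (h₁ : z.1 = z'.1)
    (h₂ : ∀ w, z.2.1 (e (.inl w)) = z'.2.1 (e (.inl w)))
    (h₃ : ∀ w, z.2.1 (e (.inr w)) = z'.2.1 (e (.inr w)))
    (h₄ : ∀ w, z.2.2 (e (.inl w)) = z'.2.2 (e (.inl w)))
    (h₅ : ∀ w, z.2.2 (e (.inr w)) = z'.2.2 (e (.inr w))) : z = z' := by
  refine homotopyComplex_ext h₁ (fun j => ?_) (fun j => ?_) <;>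
  obtain ⟨w, rfl⟩ := e.surjective j <;> rcases w with w | w
  exacts [h₂ w, h₃ w, h₄ w, h₅ w]

/-- Partial composition in `pathOperad`. -/
def pathComp :
    ((P.cx m).homotopyComplex 1 (-1) (Fin m)).X p →ₗ[k]
      ((P.cx n).homotopyComplex 1 (-1) (Fin n)).X q →ₗ[k]
      ((P.cx l).homotopyComplex 1 (-1) (Fin l)).X r :=
  LinearMap.mk₂ k (P.pathCompFun i e h)
    (fun x x' y => by
      have h₁ (w) : (x + x').2.1 w = x.2.1 w + x'.2.1 w := rfl
      have h₂ (w) : (x + x').2.2 w = x.2.2 w + x'.2.2 w := rfl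
      refine path_ext i e (P.comp_add_left i e _ _ _ _) (fun w => ?_) (fun w => ?_)
        (fun w => ?_) (fun w => ?_)
      · refine Eq.trans ?_ (congrArg₂ (· + ·) (P.pathCompFun_snd_inl i e h x y w.1 w.2)
          (P.pathCompFun_snd_inl i e h x' y w.1 w.2)).symm
        rw [pathCompFun_snd_inl, h₁, comp_add_left]
      · refine Eq.trans ?_ (congrArg₂ (· + ·) (P.pathCompFun_snd_inr i e h x y w)
          (P.pathCompFun_snd_inr i e h x' y w)).symm
        rw [pathCompFun_snd_inr, h₁, comp_add_left]
      · refine Eq.trans ?_ (congrArg₂ (· + ·) (P.pathCompFun_thd_inl i e h x y w.1 w.2)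
          (P.pathCompFun_thd_inl i e h x' y w.1 w.2)).symm
        rw [pathCompFun_thd_inl, h₂, comp_add_left]
      · refine Eq.trans ?_ (congrArg₂ (· + ·) (P.pathCompFun_thd_inr i e h x y w)
          (P.pathCompFun_thd_inr i e h x' y w)).symm
        rw [pathCompFun_thd_inr, h₁, h₂, comp_add_left, comp_add_left, smul_add]
        abel)
    (fun c x y => by
      have h₁ (w) : (c • x).2.1 w = c • x.2.1 w := rfl
      have h₂ (w) : (c • x).2.2 w = c • x.2.2 w := rfl
      refine path_ext i e (P.comp_smul_left i e _ _ _ _) (fun w => ?_) (fun w => ?_)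
        (fun w => ?_) (fun w => ?_)
      · refine Eq.trans ?_ (congrArg (c • ·) (P.pathCompFun_snd_inl i e h x y w.1 w.2)).symm
        rw [pathCompFun_snd_inl, h₁, comp_smul_left]
      · refine Eq.trans ?_ (congrArg (c • ·) (P.pathCompFun_snd_inr i e h x y w)).symm
        rw [pathCompFun_snd_inr, h₁, comp_smul_left]
      · refine Eq.trans ?_ (congrArg (c • ·) (P.pathCompFun_thd_inl i e h x y w.1 w.2)).symm
        rw [pathCompFun_thd_inl, h₂, comp_smul_left]
      · refine Eq.trans ?_ (congrArg (c • ·) (P.pathCompFun_thd_inr i e h x y w)).symm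
        rw [pathCompFun_thd_inr, h₁, h₂, comp_smul_left, comp_smul_left, smul_add, smul_comm c])
    (fun x y y' => by
      have h₀ : (y + y').1 = y.1 + y'.1 := rfl
      have h₁ (w) : (y + y').2.1 w = y.2.1 w + y'.2.1 w := rfl
      have h₂ (w) : (y + y').2.2 w = y.2.2 w + y'.2.2 w := rfl
      refine path_ext i e (P.comp_add_right i e _ _ _ _) (fun w => ?_) (fun w => ?_)
        (fun w => ?_) (fun w => ?_)
      · refine Eq.trans ?_ (congrArg₂ (· + ·) (P.pathCompFun_snd_inl i e h x y w.1 w.2)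
          (P.pathCompFun_snd_inl i e h x y' w.1 w.2)).symm
        rw [pathCompFun_snd_inl, h₀, comp_add_right]
      · refine Eq.trans ?_ (congrArg₂ (· + ·) (P.pathCompFun_snd_inr i e h x y w)
          (P.pathCompFun_snd_inr i e h x y' w)).symm
        rw [pathCompFun_snd_inr, h₁, comp_add_right]
      · refine Eq.trans ?_ (congrArg₂ (· + ·) (P.pathCompFun_thd_inl i e h x y w.1 w.2)
          (P.pathCompFun_thd_inl i e h x y' w.1 w.2)).symm
        rw [pathCompFun_thd_inl, h₀, comp_add_right]
      · refine Eq.trans ?_ (congrArg₂ (· + ·) (P.pathCompFun_thd_inr i e h x y w)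
          (P.pathCompFun_thd_inr i e h x y' w)).symm
        rw [pathCompFun_thd_inr, h₀, h₂, comp_add_right, comp_add_right, smul_add]
        abel)
    (fun c x y => by
      have h₀ : (c • y).1 = c • y.1 := rfl
      have h₁ (w) : (c • y).2.1 w = c • y.2.1 w := rfl
      have h₂ (w) : (c • y).2.2 w = c • y.2.2 w := rfl
      refine path_ext i e (P.comp_smul_right i e _ _ _ _) (fun w => ?_) (fun w => ?_)
        (fun w => ?_) (fun w => ?_)
      · refine Eq.trans ?_ (congrArg (c • ·) (P.pathCompFun_snd_inl i e h x y w.1 w.2)).symm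
        rw [pathCompFun_snd_inl, h₀, comp_smul_right]
      · refine Eq.trans ?_ (congrArg (c • ·) (P.pathCompFun_snd_inr i e h x y w)).symm
        rw [pathCompFun_snd_inr, h₁, comp_smul_right]
      · refine Eq.trans ?_ (congrArg (c • ·) (P.pathCompFun_thd_inl i e h x y w.1 w.2)).symm
        rw [pathCompFun_thd_inl, h₀, comp_smul_right]
      · refine Eq.trans ?_ (congrArg (c • ·) (P.pathCompFun_thd_inr i e h x y w)).symm
        rw [pathCompFun_thd_inr, h₀, h₂, comp_smul_right, comp_smul_right, smul_add, smul_comm c])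

theorem pathComp_fst : (P.pathComp i e h x y).1 = P.comp i e h x.1 y.1 := rfl

theorem pathComp_snd_inl (w : Fin m) (hw : w ≠ i) :
    (P.pathComp i e h x y).2.1 (e (.inl ⟨w, hw⟩)) = P.comp i e h (x.2.1 w) y.1 :=
  P.pathCompFun_snd_inl i e h x y w hw

theorem pathComp_snd_inr (w : Fin n) :
    (P.pathComp i e h x y).2.1 (e (.inr w)) = P.comp i e h (x.2.1 i) (y.2.1 w) :=
  P.pathCompFun_snd_inr i e h x y w

theorem pathComp_thd_inl (w : Fin m) (hw : w ≠ i) :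
    (P.pathComp i e h x y).2.2 (e (.inl ⟨w, hw⟩)) = P.comp i e (by lia) (x.2.2 w) y.1 :=
  P.pathCompFun_thd_inl i e h x y w hw

theorem pathComp_thd_inr (w : Fin n) :
    (P.pathComp i e h x y).2.2 (e (.inr w)) = P.comp i e (by lia) (x.2.2 i) y.1 +
        p.negOnePow • P.comp i e (by lia) (x.2.1 i) (y.2.2 w) :=
  P.pathCompFun_thd_inr i e h x y w

end PathComp

/-- The action of a permutation on `pathOperad`, which also moves the input at the end of the
path. -/
def pathAct {n : ℕ} (σ : Equiv.Perm (Fin n)) :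
    (P.cx n).homotopyComplex 1 (-1) (Fin n) ⟶ (P.cx n).homotopyComplex 1 (-1) (Fin n) :=
  homotopyMap (P.act σ) σ.symm

section PathAct

variable {n : ℕ} (σ : Equiv.Perm (Fin n)) {p : ℤ}
  (x : ((P.cx n).homotopyComplex 1 (-1) (Fin n)).X p)

theorem pathAct_snd (j : Fin n) :
    ((P.pathAct σ).f p x).2.1 j = (P.act σ).f p (x.2.1 (σ.symm j)) := rfl

theorem pathAct_thd (j : Fin n) :
    ((P.pathAct σ).f p x).2.2 j = (P.act σ).f (p - 1) (x.2.2 (σ.symm j)) := rfl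

end PathAct

end DGOperad

namespace DGOperad

open CochainComplex

variable {k : Type u} [CommRing k] (P : DGOperad k)

theorem pathComp_d {m n l : ℕ} (i : Fin m) (e : {x : Fin m // x ≠ i} ⊕ Fin n ≃ Fin l)
    {p q r p' q' r' : ℤ} (h : p + q = r) (hp : p + 1 = p') (hq : q + 1 = q') (hr : r + 1 = r')
    (h₁ : p' + q = r') (h₂ : p + q' = r')
    (a : ((P.cx m).homotopyComplex 1 (-1) (Fin m)).X p)
    (b : ((P.cx n).homotopyComplex 1 (-1) (Fin n)).X q) :
    homotopyDiff (P.cx l) 1 (-1) (Fin l) hr (P.pathComp i e h a b) =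
      P.pathComp i e h₁ (homotopyDiff (P.cx m) 1 (-1) (Fin m) hp a) b +
        p.negOnePow • P.pathComp i e h₂ a (homotopyDiff (P.cx n) 1 (-1) (Fin n) hq b) := by
  have hp' : p'.negOnePow = -p.negOnePow := by rw [← hp, Int.negOnePow_succ]
  have hpp : (p - 1).negOnePow = -p.negOnePow := by
    rw [Int.negOnePow_sub, Int.negOnePow_one, mul_neg_one]
  have d₁ {n : ℕ} {q q' : ℤ} (hq : q + 1 = q')
    (b : ((P.cx n).homotopyComplex 1 (-1) (Fin n)).X q) :
    (homotopyDiff (P.cx n) 1 (-1) (Fin n) hq b).1 = (P.cx n).d q q' b.1 := rfl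
  have d₂ {n : ℕ} {q q' : ℤ} (hq : q + 1 = q')
    (b : ((P.cx n).homotopyComplex 1 (-1) (Fin n)).X q) (w) :
    (homotopyDiff (P.cx n) 1 (-1) (Fin n) hq b).2.1 w = (P.cx n).d q q' (b.2.1 w) := rfl
  have d₃ {n : ℕ} {q q' : ℤ} (hq : q + 1 = q')
    (b : ((P.cx n).homotopyComplex 1 (-1) (Fin n)).X q) (w) :
    (homotopyDiff (P.cx n) 1 (-1) (Fin n) hq b).2.2 w =
      (P.cx n).castX (eq_sub_of_add_eq hq) b.1 - (P.cx n).castX (eq_sub_of_add_eq hq) (b.2.1 w) -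
        (P.cx n).d (q - 1) (q' - 1) (b.2.2 w) := by
    rw [← map_sub, sub_eq_add_neg b.1, ← neg_one_smul k (b.2.1 w), ← one_smul k b.1]
    rfl
  refine path_ext i e ?_ (fun ⟨w, hw⟩ => ?_) (fun w => ?_) (fun ⟨w, hw⟩ => ?_) (fun w => ?_)
  · exact P.d_comp i e h hp hq hr h₁ h₂ _ _
  · refine Eq.trans ?_ (congrArg₂ (fun x y => x + p.negOnePow • y)
      (P.pathComp_snd_inl i e _ _ _ w hw) (P.pathComp_snd_inl i e _ _ _ w hw)).symm
    rw [d₂, pathComp_snd_inl, d₂, d₁]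
    exact P.d_comp i e h hp hq hr h₁ h₂ _ _
  · refine Eq.trans ?_ (congrArg₂ (fun x y => x + p.negOnePow • y)
      (P.pathComp_snd_inr i e _ _ _ w) (P.pathComp_snd_inr i e _ _ _ w)).symm
    rw [d₂, pathComp_snd_inr, d₂, d₂]
    exact P.d_comp i e h hp hq hr h₁ h₂ _ _
  · refine Eq.trans ?_ (congrArg₂ (fun x y => x + p.negOnePow • y)
      (P.pathComp_thd_inl i e _ _ _ w hw) (P.pathComp_thd_inl i e _ _ _ w hw)).symm
    rw [d₃, pathComp_thd_inl, pathComp_snd_inl, pathComp_fst, d₃, d₁,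
      P.d_comp i e (show p - 1 + q = r - 1 by lia) (show p - 1 + 1 = p' - 1 by lia) hq
        (show r - 1 + 1 = r' - 1 by lia) (show p' - 1 + q = r' - 1 by lia) (by lia), hpp]
    simp only [comp_sub_left, castX_comp, comp_castX_left, Units.neg_smul]
    abel
  · refine Eq.trans ?_ (congrArg₂ (fun x y => x + p.negOnePow • y)
      (P.pathComp_thd_inr i e _ _ _ w) (P.pathComp_thd_inr i e _ _ _ w)).symm
    rw [d₃, pathComp_thd_inr, pathComp_snd_inr, pathComp_fst, d₃, d₃, d₂, d₁, d_add, d_units_smul,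
      P.d_comp i e (show p - 1 + q = r - 1 by lia) (show p - 1 + 1 = p' - 1 by lia) hq
        (show r - 1 + 1 = r' - 1 by lia) (show p' - 1 + q = r' - 1 by lia) (by lia),
      P.d_comp i e (show p + (q - 1) = r - 1 by lia) hp (show q - 1 + 1 = q' - 1 by lia)
        (show r - 1 + 1 = r' - 1 by lia) (by lia) (show p + (q' - 1) = r' - 1 by lia), hp', hpp]
    simp only [comp_sub_left, comp_sub_right, castX_comp, comp_castX_left,
      comp_castX_right, smul_add, smul_sub, smul_smul, Int.units_mul_self, Units.neg_smul,
      one_smul]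
    abel

theorem pathComp_assoc {m n q u v l : ℕ} (i : Fin m) (j : Fin n)
    (e : {x : Fin m // x ≠ i} ⊕ Fin n ≃ Fin u)
    (f : {x : Fin u // x ≠ e (.inr j)} ⊕ Fin q ≃ Fin l)
    (f' : {x : Fin n // x ≠ j} ⊕ Fin q ≃ Fin v)
    (e' : {x : Fin m // x ≠ i} ⊕ Fin v ≃ Fin l)
    (h₁ : ∀ x hx, f (.inl ⟨e (.inl x), hx⟩) = e' (.inl x))
    (h₂ : ∀ y hy, f (.inl ⟨e (.inr y.1), hy⟩) = e' (.inr (f' (.inl y))))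
    (h₃ : ∀ z, f (.inr z) = e' (.inr (f' (.inr z))))
    {α β γ δ ε ζ : ℤ} (hαβ : α + β = δ) (hδγ : δ + γ = ζ) (hβγ : β + γ = ε) (hαε : α + ε = ζ)
    (a : ((P.cx m).homotopyComplex 1 (-1) (Fin m)).X α)
    (b : ((P.cx n).homotopyComplex 1 (-1) (Fin n)).X β)
    (c : ((P.cx q).homotopyComplex 1 (-1) (Fin q)).X γ) :
    P.pathComp (e (.inr j)) f hδγ (P.pathComp i e hαβ a b) c =
      P.pathComp i e' hαε a (P.pathComp j f' hβγ b c) := by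
  have A {α β γ δ ε ζ : ℤ} (hαβ : α + β = δ) (hδγ : δ + γ = ζ) (hβγ : β + γ = ε)
      (hαε : α + ε = ζ) := P.assoc i j e f f' e' h₁ h₂ h₃ hαβ hδγ hβγ hαε
  refine homotopyComplex_ext ?_ (fun t => ?_) (fun t => ?_)
  · exact A hαβ hδγ hβγ hαε _ _ _
  all_goals obtain ⟨⟨w, hw⟩ | z, rfl⟩ := f.surjective t
  · obtain ⟨⟨x, hx⟩ | y, rfl⟩ := e.surjective w
    · rw [pathComp_snd_inl, pathComp_snd_inl, h₁, pathComp_snd_inl, pathComp_fst]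
      exact A _ _ _ _ _ _ _
    · have hy : y ≠ j := fun h => hw (by rw [h])
      rw [pathComp_snd_inl, pathComp_snd_inr, h₂ ⟨y, hy⟩, pathComp_snd_inr, pathComp_snd_inl]
      exact A _ _ _ _ _ _ _
  · rw [pathComp_snd_inr, pathComp_snd_inr, h₃, pathComp_snd_inr, pathComp_snd_inr]
    exact A _ _ _ _ _ _ _
  · obtain ⟨⟨x, hx⟩ | y, rfl⟩ := e.surjective w
    · rw [pathComp_thd_inl, pathComp_thd_inl, h₁, pathComp_thd_inl, pathComp_fst]
      exact A _ _ _ _ _ _ _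
    · have hy : y ≠ j := fun h => hw (by rw [h])
      rw [pathComp_thd_inl, pathComp_thd_inr, h₂ ⟨y, hy⟩, pathComp_thd_inr, pathComp_thd_inl,
        pathComp_fst, comp_add_left, comp_units_smul_left,
        A _ _ hβγ (by lia), A _ _ (by lia) (show α + (ε - 1) = ζ - 1 by lia)]
  · rw [pathComp_thd_inr, pathComp_thd_inr, h₃, pathComp_thd_inr, pathComp_thd_inr,
      pathComp_snd_inr, pathComp_fst, comp_add_left, comp_add_right, comp_units_smul_left,
      comp_units_smul_right, A _ _ hβγ (by lia),
      A _ _ (by lia) (show α + (ε - 1) = ζ - 1 by lia),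
      A _ _ (by lia) (show α + (ε - 1) = ζ - 1 by lia), ← hαβ, Int.negOnePow_add, mul_smul,
      smul_add, add_assoc]

theorem pathComp_parallel {m n q u v l : ℕ} (i j : Fin m) (hji : j ≠ i) (hij : i ≠ j)
    (e : {x : Fin m // x ≠ i} ⊕ Fin n ≃ Fin u)
    (f : {x : Fin u // x ≠ e (.inl ⟨j, hji⟩)} ⊕ Fin q ≃ Fin l)
    (e' : {x : Fin m // x ≠ j} ⊕ Fin q ≃ Fin v)
    (f' : {x : Fin v // x ≠ e' (.inl ⟨i, hij⟩)} ⊕ Fin n ≃ Fin l)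
    (h₁ : ∀ x hi hj hx hx',
      f (.inl ⟨e (.inl ⟨x, hi⟩), hx⟩) = f' (.inl ⟨e' (.inl ⟨x, hj⟩), hx'⟩))
    (h₂ : ∀ y hy, f (.inl ⟨e (.inr y), hy⟩) = f' (.inr y))
    (h₃ : ∀ z hz, f (.inr z) = f' (.inl ⟨e' (.inr z), hz⟩))
    {α β γ δ ε ζ : ℤ} (hαβ : α + β = δ) (hδγ : δ + γ = ζ) (hαγ : α + γ = ε) (hεβ : ε + β = ζ)
    (a : ((P.cx m).homotopyComplex 1 (-1) (Fin m)).X α)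
    (b : ((P.cx n).homotopyComplex 1 (-1) (Fin n)).X β)
    (c : ((P.cx q).homotopyComplex 1 (-1) (Fin q)).X γ) :
    P.pathComp (e (.inl ⟨j, hji⟩)) f hδγ (P.pathComp i e hαβ a b) c =
      (β * γ).negOnePow •
        P.pathComp (e' (.inl ⟨i, hij⟩)) f' hεβ (P.pathComp j e' hαγ a c) b := by
  have A {α β γ δ ε ζ : ℤ} (hαβ : α + β = δ) (hδγ : δ + γ = ζ) (hαγ : α + γ = ε)
      (hεβ : ε + β = ζ) := P.parallel i j hji hij e f e' f' h₁ h₂ h₃ hαβ hδγ hαγ hεβ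
  refine homotopyComplex_ext ?_ (fun t => ?_) (fun t => ?_)
  · exact A hαβ hδγ hαγ hεβ _ _ _
  · change _ = (β * γ).negOnePow •
      (P.pathComp (e' (.inl ⟨i, hij⟩)) f' hεβ (P.pathComp j e' hαγ a c) b).2.1 t
    obtain ⟨⟨w, hw⟩ | z, rfl⟩ := f.surjective t
    · obtain ⟨⟨x, hx⟩ | y, rfl⟩ := e.surjective w
      · have hxj : x ≠ j := fun h => hw (by subst h; rfl)
        have hx' : e' (.inl ⟨x, hxj⟩) ≠ e' (.inl ⟨i, hij⟩) := by simpa using hx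
        rw [pathComp_snd_inl, pathComp_snd_inl, h₁ x hx hxj hw hx', pathComp_snd_inl,
          pathComp_snd_inl]
        exact A _ _ _ _ _ _ _
      · rw [pathComp_snd_inl, pathComp_snd_inr, h₂, pathComp_snd_inr, pathComp_snd_inl]
        exact A _ _ _ _ _ _ _
    · have hz : e' (.inr z) ≠ e' (.inl ⟨i, hij⟩) := by simp
      rw [pathComp_snd_inr, pathComp_snd_inl, h₃ z hz, pathComp_snd_inl, pathComp_snd_inr]
      exact A _ _ _ _ _ _ _
  · change _ = (β * γ).negOnePow •
      (P.pathComp (e' (.inl ⟨i, hij⟩)) f' hεβ (P.pathComp j e' hαγ a c) b).2.2 t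
    obtain ⟨⟨w, hw⟩ | z, rfl⟩ := f.surjective t
    · obtain ⟨⟨x, hx⟩ | y, rfl⟩ := e.surjective w
      · have hxj : x ≠ j := fun h => hw (by subst h; rfl)
        have hx' : e' (.inl ⟨x, hxj⟩) ≠ e' (.inl ⟨i, hij⟩) := by simpa using hx
        rw [pathComp_thd_inl, pathComp_thd_inl, h₁ x hx hxj hw hx', pathComp_thd_inl,
          pathComp_thd_inl]
        exact A _ _ _ _ _ _ _
      · rw [pathComp_thd_inl, pathComp_thd_inr, h₂, pathComp_thd_inr, pathComp_thd_inl,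
          pathComp_snd_inl, comp_add_left, comp_units_smul_left,
          A _ _ (show α - 1 + γ = ε - 1 by lia) (by lia), A _ _ hαγ (by lia), smul_smul,
          negOnePow_parallel_left hαγ, smul_add, smul_smul]
    · have hz : e' (.inr z) ≠ e' (.inl ⟨i, hij⟩) := by simp
      rw [pathComp_thd_inr, pathComp_thd_inl, pathComp_snd_inl, h₃ z hz, pathComp_thd_inl,
        pathComp_thd_inr, comp_add_left, comp_units_smul_left,
        A _ _ (show α - 1 + γ = ε - 1 by lia) (by lia),
        A _ _ (show α + (γ - 1) = ε - 1 by lia) (by lia), smul_smul,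
        negOnePow_parallel_right hαβ, smul_add, smul_smul]

/-- The triple of an operation with the constant family and the zero family. -/
def pathTriple {n : ℕ} {p : ℤ} (x : (P.cx n).X p) :
    ((P.cx n).homotopyComplex 1 (-1) (Fin n)).X p := (x, fun _ => x, 0)

theorem pathTriple_thd {n : ℕ} {p : ℤ} (x : (P.cx n).X p) (w : Fin n) :
    (P.pathTriple x).2.2 w = 0 := rfl

theorem pathComp_pathTriple {m n l : ℕ} (i : Fin m) (e : {x : Fin m // x ≠ i} ⊕ Fin n ≃ Fin l)
    {p q r : ℤ} (h : p + q = r) (a : (P.cx m).X p) (b : (P.cx n).X q) :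
    P.pathComp i e h (P.pathTriple a) (P.pathTriple b) = P.pathTriple (P.comp i e h a b) := by
  refine path_ext i e rfl (fun ⟨w, hw⟩ => ?_) (fun w => ?_) (fun ⟨w, hw⟩ => ?_) (fun w => ?_)
  · rw [pathComp_snd_inl]
    rfl
  · rw [pathComp_snd_inr]
    rfl
  · rw [pathComp_thd_inl, pathTriple_thd, pathTriple_thd, map_zero, LinearMap.zero_apply]
  · rw [pathComp_thd_inr, pathTriple_thd, pathTriple_thd, pathTriple_thd, map_zero, map_zero,
      LinearMap.zero_apply, smul_zero, add_zero]

/-- The operad whose operations of arity `n` are triples `(a, f, h)` of an operation `a` of `P` and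
two families `f` and `h` of operations of `P`, indexed by the `n` inputs, with `h` of degree one
less. A morphism `O ⟶ pathOperad P` consists of a morphism `a` and, for each input `j`, a morphism
of complexes `f j` and a homotopy `h j` from `a` to `f j`. On a partial composition `x ∘ᵢ y`, the
map `f j` is `f j x ∘ᵢ a y` if `j` is an input of `x`, and `f i x ∘ᵢ f j y` if `j` is an input of
`y`: it acts on the operations along the path from the root to the input `j`. -/
def pathOperad : DGOperad k where
  cx n := (P.cx n).homotopyComplex 1 (-1) (Fin n)
  act σ := P.pathAct σ
  act_one n := by
    ext p x
    exact homotopyComplex_ext (P.act_one_apply _) (fun _ => P.act_one_apply _)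
      (fun _ => P.act_one_apply _)
  act_mul σ τ := by
    ext p x
    exact homotopyComplex_ext (P.act_act _ _ _).symm (fun _ => (P.act_act _ _ _).symm)
      (fun _ => (P.act_act _ _ _).symm)
  one := P.pathTriple P.one
  d_one := by
    refine (homotopyComplex_d_apply _ _ _ _ (zero_add 1) _).trans ?_
    refine homotopyComplex_ext P.d_one (fun j => P.d_one) (fun j => ?_)
    simp [homotopyDiff, pathTriple]
    rfl
  comp i e _ _ _ h := P.pathComp i e h
  d_comp i e p q r p' q' r' h hp hq hr h₁ h₂ a b := by
    rw [homotopyComplex_d_apply _ _ _ _ hr, homotopyComplex_d_apply _ _ _ _ hp,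
      homotopyComplex_d_apply _ _ _ _ hq]
    exact P.pathComp_d i e h hp hq hr h₁ h₂ a b
  act_comp i e ρ _ _ _ h a b := by
    refine path_ext i (e.trans ρ) (P.act_comp _ _ _ _ _ _) (fun ⟨w, hw⟩ => ?_) (fun w => ?_)
      (fun ⟨w, hw⟩ => ?_) (fun w => ?_)
    · rw [pathComp_snd_inl, pathAct_snd, Equiv.trans_apply, Equiv.symm_apply_apply,
        pathComp_snd_inl, P.act_comp]
    · rw [pathComp_snd_inr, pathAct_snd, Equiv.trans_apply, Equiv.symm_apply_apply,
        pathComp_snd_inr, P.act_comp]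
    · rw [pathComp_thd_inl, pathAct_thd, Equiv.trans_apply, Equiv.symm_apply_apply,
        pathComp_thd_inl, P.act_comp]
    · rw [pathComp_thd_inr, pathAct_thd, Equiv.trans_apply, Equiv.symm_apply_apply,
        pathComp_thd_inr, map_add, P.act_comp, Units.smul_def, map_zsmul, P.act_comp]
      rfl
  comp_act i σ τ e e' h₁ h₂ _ _ _ h a b := by
    have A {p q r : ℤ} (h : p + q = r) := P.comp_act i σ τ e e' h₁ h₂ h
    refine path_ext i e' (A _ _ _) (fun ⟨w, hw⟩ => ?_) (fun w => ?_)
      (fun ⟨w, hw⟩ => ?_) (fun w => ?_)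
    · rw [pathComp_snd_inl, ← h₁ w (σ.injective.ne hw) hw, pathComp_snd_inl, pathAct_snd,
        Equiv.symm_apply_apply]
      exact A _ _ _
    · rw [pathComp_snd_inr, ← h₂, pathComp_snd_inr, pathAct_snd, pathAct_snd,
        Equiv.symm_apply_apply, Equiv.symm_apply_apply]
      exact A _ _ _
    · rw [pathComp_thd_inl, ← h₁ w (σ.injective.ne hw) hw, pathComp_thd_inl, pathAct_thd,
        Equiv.symm_apply_apply]
      exact A _ _ _
    · rw [pathComp_thd_inr, ← h₂, pathComp_thd_inr, pathAct_thd, pathAct_thd, pathAct_snd,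
        Equiv.symm_apply_apply, Equiv.symm_apply_apply]
      exact congrArg₂ (fun x y => x + Int.negOnePow _ • y) (A _ _ _) (A _ _ _)
  one_comp i e he q b := by
    refine path_ext i e (P.one_comp i e he _) (fun w => absurd (Subsingleton.elim _ _) w.2)
      (fun w => ?_) (fun w => absurd (Subsingleton.elim _ _) w.2) (fun w => ?_)
    · rw [pathComp_snd_inr, he]
      exact P.one_comp i e he _
    · rw [pathComp_thd_inr, he]
      change P.comp i e _ 0 b.1 + Int.negOnePow 0 • P.comp i e _ P.one (b.2.2 w) = _
      rw [map_zero, LinearMap.zero_apply, zero_add, P.one_comp i e he, Int.negOnePow_zero, one_smul]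
  comp_one i e he p a := by
    have hi (w : Fin 1) : e (.inr w) = i := by
      obtain ⟨x | z, hz⟩ := e.surjective i
      · exact absurd ((he x).symm.trans hz) x.2
      · rw [Subsingleton.elim w z]
        exact hz
    refine path_ext i e (P.comp_one i e he _) (fun ⟨w, hw⟩ => ?_) (fun w => ?_)
      (fun ⟨w, hw⟩ => ?_) (fun w => ?_)
    · rw [pathComp_snd_inl, he]
      exact P.comp_one i e he _
    · rw [pathComp_snd_inr, hi]
      exact P.comp_one i e he _
    · rw [pathComp_thd_inl, he]
      exact P.comp_one i e he _
    · rw [pathComp_thd_inr, hi]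
      change P.comp i e _ (a.2.2 i) P.one + Int.negOnePow p • P.comp i e _ (a.2.1 i) 0 = _
      rw [map_zero, smul_zero, add_zero, P.comp_one i e he]
  assoc := P.pathComp_assoc
  parallel := P.pathComp_parallel

end DGOperad

/-! ### Contractible complexes of generators -/

namespace CochainComplex

variable {k : Type u} [CommRing k] {M : CochainComplex (ModuleCat.{u} k) ℤ}

/-- A contracting homotopy, as a family of linear maps of degree `-1`. -/
def contraction (H : Homotopy (𝟙 M) 0) (p : ℤ) : M.X p →ₗ[k] M.X (p - 1) :=
  (H.hom p (p - 1)).hom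

theorem contraction_spec (H : Homotopy (𝟙 M) 0) {p p' : ℤ} (h : p + 1 = p') (x : M.X p) :
    M.castX (eq_sub_of_add_eq h) x - M.d (p - 1) (p' - 1) (contraction H p x) =
      contraction H p' (M.d p p' x) := by
  have h₁ := H.comm p
  rw [dNext_eq _ (show (ComplexShape.up ℤ).Rel p p' from h),
    prevD_eq _ (show (ComplexShape.up ℤ).Rel (p - 1) p from sub_add_cancel p 1)] at h₁
  have h₂ : x = H.hom p' p (M.d p p' x) + M.d (p - 1) p (contraction H p x) := by
    have := congrArg (fun f => f x) h₁
    simpa using! this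
  have h₃ {q q' : ℤ} (hq : q = q') (y : M.X p') : M.castX hq (H.hom p' q y) = H.hom p' q' y := by
    subst hq
    simp
  have h₄ := congrArg (M.castX (eq_sub_of_add_eq h)) h₂
  rw [map_add, h₃, castX_d] at h₄
  rw [h₄, add_sub_cancel_right]
  rfl

end CochainComplex

/-- The cone of an identity morphism is contractible, and so are its shifts. -/
noncomputable def shiftedConeContraction (k : Type u) [CommRing k] (s : ℤ) :
    Homotopy (𝟙 (shiftedCone k s)) 0 :=
  let K := (CochainComplex.singleFunctor (ModuleCat.{u} k) 0).obj (ModuleCat.of k k)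
  let h : Homotopy (𝟙 (CochainComplex.mappingCone (𝟙 K))) 0 :=
    CochainComplex.mappingCone.liftHomotopy _ _ _ (CochainComplex.mappingCone.snd _) 0
      (by simp) (by simp)
  (Homotopy.ofEq (CategoryTheory.Functor.map_id _ _).symm).trans
    ((h.shift s).trans (Homotopy.ofEq (Functor.map_zero _ _ _)))

namespace DGOperad

open CochainComplex HomologicalComplex

variable {k : Type u} [CommRing k]

/-! ### The projection of the coproduct that kills the generators -/

section Projection

variable (O : DGOperad k) (M : CochainComplex (ModuleCat.{u} k) ℤ) (n : ℕ)

/-- The retraction of `O ⨿ F(M, n)` onto `O` that sends `M` to zero. -/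
noncomputable def retraction : O ⨿ freeOperad M n ⟶ O := coprod.desc (𝟙 O) (freeOperad.lift 0)

/-- The idempotent endomorphism of `O ⨿ F(M, n)` with image `O` that sends `M` to zero. -/
noncomputable def projection : O ⨿ freeOperad M n ⟶ O ⨿ freeOperad M n :=
  retraction O M n ≫ coprod.inl

variable {O M n}

theorem projection_inl {m : ℕ} {p : ℤ} (x : (O.cx m).X p) :
    ((projection O M n).app m).f p
        ((Hom.app (coprod.inl : O ⟶ O ⨿ freeOperad M n) m).f p x) =
      (Hom.app (coprod.inl : O ⟶ O ⨿ freeOperad M n) m).f p x := by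
  have h : coprod.inl ≫ projection O M n = coprod.inl := by
    rw [projection, retraction, coprod.inl_desc_assoc, Category.id_comp]
  exact congrArg (fun f : O ⟶ O ⨿ freeOperad M n => (f.app m).f p x) h

theorem projection_gen {p : ℤ} (x : M.X p) :
    ((projection O M n).app n).f p ((coprodGen O M n).f p x) = 0 := by
  have h : coprodGen O M n ≫ (retraction O M n).app n = 0 := coprodGen_desc _ _
  refine (congrArg ((Hom.app (coprod.inl : O ⟶ O ⨿ freeOperad M n) n).f p)
    (congrArg (fun f => f.f p x) h)).trans ?_
  exact map_zero _

/-- It is enough that each operation has the same image under the projection as under an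
endomorphism of the complex that is the identity on homology. -/
theorem quasiIso_inl_of_locally (r : ℕ)
    (h : ∀ p (x : ((O ⨿ freeOperad M n).cx r).X p),
      ∃ e : (O ⨿ freeOperad M n).cx r ⟶ (O ⨿ freeOperad M n).cx r,
        (∀ q, homologyMap e q = 𝟙 _) ∧ e.f p x = ((projection O M n).app r).f p x) :
    QuasiIso ((coprod.inl : O ⟶ O ⨿ freeOperad M n).app r) := by
  refine quasiIso_of_retraction _ ((retraction O M n).app r) ?_
    (homologyMap_eq_id_of_locally _ h)
  rw [← comp_app, retraction, coprod.inl_desc, id_app]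

end Projection

/-! ### Coefficients containing the rational numbers -/

section Derivation

variable (P : DGOperad k)

/-- The projection of `derivationOperad P` to the first component. -/
def derivationFst : derivationOperad P ⟶ P :=
  Hom.mk (fun _ => homotopyFst (𝟙 _)) (fun _ => rfl) rfl (fun _ _ _ _ _ _ _ _ => rfl)

/-- The section of `derivationFst` that corresponds to the zero derivation. -/
def derivationConst : P ⟶ derivationOperad P :=
  Hom.mk (fun _ => homotopyLift (𝟙 _) (fun _ => 0) (fun _ _ => 0) (by intros; simp))
    (fun σ => by
      ext p x
      exact homotopyComplex_ext rfl (fun _ => (map_zero ((P.act σ).f _).hom).symm)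
        (fun _ => (map_zero ((P.act σ).f _).hom).symm))
    rfl
    (fun i e p q r h a b => by
      refine homotopyComplex_ext rfl (fun _ => ?_) (fun _ => ?_)
      · change 0 = P.comp i e h 0 b + P.comp i e h a 0
        simp
      · change 0 = P.comp i e _ 0 b + p.negOnePow • P.comp i e _ a 0
        simp)

variable {P} (φ : P ⟶ derivationOperad P)

/-- The degree zero derivation of a morphism to `derivationOperad`. -/
def derivationMap (n : ℕ) : P.cx n ⟶ P.cx n := homotopySnd (φ.app n) ()

theorem derivationMap_apply {n : ℕ} {p : ℤ} (x : (P.cx n).X p) :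
    (derivationMap φ n).f p x = ((φ.app n).f p x).2.1 () := rfl

theorem derivationMap_act {n : ℕ} {p : ℤ} (σ : Equiv.Perm (Fin n)) (x : (P.cx n).X p) :
    (derivationMap φ n).f p ((P.act σ).f p x) = (P.act σ).f p ((derivationMap φ n).f p x) :=
  congrArg (fun y => y.2.1 ()) (φ.map_act_apply σ x)

theorem derivationMap_one : (derivationMap φ 1).f 0 P.one = 0 :=
  congrArg (fun y => y.2.1 ()) φ.map_one

theorem homologyMap_derivationMap (n : ℕ) (q : ℤ) : homologyMap (derivationMap φ n) q = 0 := by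
  have h := (homotopyThd (φ.app n) ()).homologyMap_eq q
  rwa [zero_smul, one_smul, zero_add, homologyMap_zero] at h

/-- The product of the operators `1 - c w • D` for `1 ≤ w ≤ N`. -/
noncomputable def derivationProd (c : ℕ → k) (n : ℕ) : ℕ → (P.cx n ⟶ P.cx n)
  | 0 => 𝟙 _
  | N + 1 => derivationProd c n N ≫ (𝟙 _ - c (N + 1) • derivationMap φ n)

theorem homologyMap_derivationProd (c : ℕ → k) (n N : ℕ) (q : ℤ) :
    homologyMap (derivationProd φ c n N) q = 𝟙 _ := by
  induction N with
  | zero => exact homologyMap_id _ _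
  | succ N ih =>
    have h : c (N + 1) • derivationMap φ n = derivationMap φ n ≫ (c (N + 1) • 𝟙 _) := by
      rw [Linear.comp_smul, Category.comp_id]
    rw [derivationProd, homologyMap_comp, ih, homologyMap_sub, h, homologyMap_comp,
      homologyMap_derivationMap, homologyMap_id, zero_comp, sub_zero, Category.id_comp]

variable {φ}

theorem derivationProd_succ_apply (c : ℕ → k) {n : ℕ} {p : ℤ} (N : ℕ) (x : (P.cx n).X p) :
    (derivationProd φ c n (N + 1)).f p x =
      (derivationProd φ c n N).f p x -
        c (N + 1) • (derivationMap φ n).f p ((derivationProd φ c n N).f p x) := rfl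

theorem derivationProd_of_zero (c : ℕ → k) {n : ℕ} {p : ℤ} {x : (P.cx n).X p}
    (hx : (derivationMap φ n).f p x = 0) (N : ℕ) : (derivationProd φ c n N).f p x = x := by
  induction N with
  | zero => rfl
  | succ N ih => rw [derivationProd_succ_apply, ih, hx, smul_zero, sub_zero]

theorem derivationMap_derivationProd (c : ℕ → k) {n : ℕ} {p : ℤ} {x : (P.cx n).X p} {w : k}
    (hx : (derivationMap φ n).f p x = w • x) (N : ℕ) :
    (derivationMap φ n).f p ((derivationProd φ c n N).f p x) =
      w • (derivationProd φ c n N).f p x := by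
  induction N with
  | zero => exact hx
  | succ N ih =>
    rw [derivationProd_succ_apply, ih, map_sub, map_smul, map_smul, ih, smul_sub,
      smul_comm w (c (N + 1))]

theorem derivationProd_of_weight (c : ℕ → k) (hc : ∀ w : ℕ, w ≠ 0 → c w * w = 1) {n : ℕ} {p : ℤ}
    {x : (P.cx n).X p} {w : ℕ} (hw : w ≠ 0) (hx : (derivationMap φ n).f p x = (w : k) • x)
    {N : ℕ} (hN : w ≤ N) : (derivationProd φ c n N).f p x = 0 := by
  induction N, hN using Nat.le_induction with
  | base =>
    obtain ⟨v, rfl⟩ := Nat.exists_eq_succ_of_ne_zero hw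
    rw [derivationProd_succ_apply, derivationMap_derivationProd c hx, smul_smul, hc _ hw, one_smul,
      sub_self]
  | succ N _ ih => rw [derivationProd_succ_apply, ih, map_zero, smul_zero, sub_zero]

theorem derivationMap_comp (hφ : ∀ n p (x : (P.cx n).X p), ((φ.app n).f p x).1 = x)
    {m n l : ℕ} (i : Fin m) (e : {x : Fin m // x ≠ i} ⊕ Fin n ≃ Fin l)
    {p q r : ℤ} (h : p + q = r) (a : (P.cx m).X p) (b : (P.cx n).X q) :
    (derivationMap φ l).f r (P.comp i e h a b) =
      P.comp i e h ((derivationMap φ m).f p a) b + P.comp i e h a ((derivationMap φ n).f q b) := by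
  have h₁ := congrArg (fun y => y.2.1 ()) (φ.map_comp i e h a b)
  refine h₁.trans ?_
  change P.comp i e h _ ((φ.app n).f q b).1 + P.comp i e h ((φ.app m).f p a).1 _ = _
  rw [hφ, hφ]
  rfl

end Derivation

end DGOperad

namespace DGOperad

open CochainComplex HomologicalComplex

variable {k : Type u} [CommRing k]

section CoprodDerivation

variable (O : DGOperad k) {M : CochainComplex (ModuleCat.{u} k) ℤ} (H : Homotopy (𝟙 M) 0) (n : ℕ)

/-- The derivation of degree `-1` on `O ⨿ F(M, n)` that vanishes on `O` and restricts to the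
contraction of `M`, together with the derivation of degree zero that it bounds. The latter vanishes
on `O` and is the identity on `M`. -/
noncomputable def coprodDerivation : O ⨿ freeOperad M n ⟶ derivationOperad (O ⨿ freeOperad M n) :=
  coprod.desc (coprod.inl ≫ derivationConst _) (freeOperad.lift
    (homotopyLift (coprodGen O M n) (fun _ => coprodGen O M n)
      (fun _ p => ((coprodGen O M n).f (p - 1)).hom.comp (contraction H p))
      (fun _ p p' hp x => by
        have h := congrArg ((coprodGen O M n).f (p' - 1)) (contraction_spec H hp x)
        rw [map_sub, map_castX, map_d] at h
        rw [zero_smul, zero_add, one_smul]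
        exact h)))

theorem coprodDerivation_inl {m : ℕ} {p : ℤ} (x : (O.cx m).X p) :
    ((coprodDerivation O H n).app m).f p
        ((Hom.app (coprod.inl : O ⟶ O ⨿ freeOperad M n) m).f p x) =
      ((Hom.app (coprod.inl : O ⟶ O ⨿ freeOperad M n) m).f p x, fun _ => 0, fun _ => 0) :=
  congrArg (fun f : O ⟶ derivationOperad (O ⨿ freeOperad M n) => (f.app m).f p x)
    (coprod.inl_desc _ _)

theorem coprodDerivation_gen {p : ℤ} (x : M.X p) :
    ((coprodDerivation O H n).app n).f p ((coprodGen O M n).f p x) =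
      ((coprodGen O M n).f p x, fun _ => (coprodGen O M n).f p x,
        fun _ => (coprodGen O M n).f (p - 1) (contraction H p x)) :=
  congrArg (fun f : M ⟶ (derivationOperad (O ⨿ freeOperad M n)).cx n => f.f p x)
    (coprodGen_desc _ _)

theorem coprodDerivation_fst {m : ℕ} {p : ℤ} (x : ((O ⨿ freeOperad M n).cx m).X p) :
    (((coprodDerivation O H n).app m).f p x).1 = x := by
  have h : coprodDerivation O H n ≫ derivationFst _ = 𝟙 _ := by
    refine coprod_free_hom_ext ?_ ?_
    · ext m p x
      exact congrArg Prod.fst (coprodDerivation_inl O H n x)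
    · ext p x
      exact congrArg Prod.fst (coprodDerivation_gen O H n x)
  exact congrArg (fun f : O ⨿ freeOperad M n ⟶ O ⨿ freeOperad M n => (f.app m).f p x) h

/-- The properties shared by the operations with `w` occurrences of elements of `M`: they are
eigenvectors of the degree zero derivation with eigenvalue `w`, and the projection multiplies them
by `0 ^ w`, that is, it fixes them if `w = 0` and kills them otherwise. -/
def IsOfWeight (w : ℕ) {m : ℕ} {p : ℤ} (x : ((O ⨿ freeOperad M n).cx m).X p) : Prop :=
  (derivationMap (coprodDerivation O H n) m).f p x = (w : k) • x ∧
    ((projection O M n).app m).f p x = (0 : k) ^ w • x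

theorem isOfWeight_comp {w w' : ℕ} {m n' l : ℕ} (i : Fin m)
    (e : {x : Fin m // x ≠ i} ⊕ Fin n' ≃ Fin l) {p q r : ℤ} (h : p + q = r)
    {a : ((O ⨿ freeOperad M n).cx m).X p} {b : ((O ⨿ freeOperad M n).cx n').X q}
    (ha : IsOfWeight O H n w a) (hb : IsOfWeight O H n w' b) :
    IsOfWeight O H n (w + w') ((O ⨿ freeOperad M n).comp i e h a b) := by
  constructor
  · rw [derivationMap_comp (fun _ _ => coprodDerivation_fst O H n), ha.1, hb.1, comp_smul_left,
      comp_smul_right, ← add_smul, Nat.cast_add]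
  · rw [Hom.map_comp, ha.2, hb.2, comp_smul_left, comp_smul_right, smul_smul, pow_add]

/-- Every operation of `O ⨿ F(M, n)` is a sum of operations that have a weight. -/
theorem mem_span_isOfWeight {m : ℕ} {p : ℤ} (x : ((O ⨿ freeOperad M n).cx m).X p) :
    x ∈ Submodule.span k {y | ∃ w, IsOfWeight O H n w y} := by
  have map {m m' : ℕ} {p p' : ℤ}
      (T : ((O ⨿ freeOperad M n).cx m).X p →ₗ[k] ((O ⨿ freeOperad M n).cx m').X p')
      {x : ((O ⨿ freeOperad M n).cx m).X p}
      (hx : x ∈ Submodule.span k {y | ∃ w, IsOfWeight O H n w y})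
      (hT : ∀ w y, IsOfWeight O H n w y →
        T y ∈ Submodule.span k {y | ∃ w, IsOfWeight O H n w y}) :
      T x ∈ Submodule.span k {y | ∃ w, IsOfWeight O H n w y} := by
    have h : Submodule.span k {y | ∃ w, IsOfWeight O H n w y} ≤
        (Submodule.span k {y | ∃ w, IsOfWeight O H n w y}).comap T := by
      rw [Submodule.span_le]
      rintro y ⟨w, hw⟩
      exact hT w y hw
    exact h hx
  refine IsClosedPred.coprod
    (S := fun m p x => x ∈ Submodule.span k {y | ∃ w, IsOfWeight O H n w y}) ?_ ?_ ?_ x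
  · exact
    { zero := fun _ _ => Submodule.zero_mem _
      add := fun ha hb => Submodule.add_mem _ ha hb
      smul := fun c _ ha => Submodule.smul_mem _ c ha
      diff := fun {m p p'} h a ha => map ((O ⨿ freeOperad M n).cx m |>.d p p').hom ha
        fun w y hy => Submodule.subset_span ⟨w, by
          constructor
          · exact (map_d _ _).trans ((congrArg _ hy.1).trans (map_smul _ _ _))
          · exact (map_d _ _).trans ((congrArg _ hy.2).trans (map_smul _ _ _))⟩
      act := fun {m p} σ a ha => map (((O ⨿ freeOperad M n).act σ).f p).hom ha
        fun w y hy => Submodule.subset_span ⟨w, by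
          constructor
          · exact (derivationMap_act _ _ _).trans ((congrArg _ hy.1).trans (map_smul _ _ _))
          · exact (Hom.map_act_apply _ _ _).trans ((congrArg _ hy.2).trans (map_smul _ _ _))⟩
      one := Submodule.subset_span ⟨0, by
        constructor
        · rw [derivationMap_one, Nat.cast_zero, zero_smul]
        · rw [Hom.map_one, pow_zero, one_smul]⟩
      comp := fun {m n' l} i e {p q r} h {a b} ha hb =>
        map ((O ⨿ freeOperad M n).comp i e h a) hb fun w y hy =>
          map (((O ⨿ freeOperad M n).comp i e h).flip y) ha fun w' z hz =>
            Submodule.subset_span ⟨w' + w, isOfWeight_comp O H n i e h hz hy⟩ }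
  · refine fun m p x => Submodule.subset_span ⟨0, ?_, ?_⟩
    · rw [derivationMap_apply, coprodDerivation_inl, Nat.cast_zero, zero_smul]
    · rw [projection_inl, pow_zero, one_smul]
  · refine fun p x => Submodule.subset_span ⟨1, ?_, ?_⟩
    · rw [derivationMap_apply, coprodDerivation_gen, Nat.cast_one, one_smul]
    · rw [projection_gen, pow_one, zero_smul]

end CoprodDerivation

/-- If `k` contains the rational numbers, then the inclusion of `O` in the coproduct with
a free operad on a contractible complex is a quasi-isomorphism. -/
theorem quasiIso_inl_of_rat (O : DGOperad k) {M : CochainComplex (ModuleCat.{u} k) ℤ}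
    (H : Homotopy (𝟙 M) 0) (n : ℕ) (hk : Nonempty (ℚ →+* k)) (r : ℕ) :
    QuasiIso ((coprod.inl : O ⟶ O ⨿ freeOperad M n).app r) := by
  obtain ⟨ψ⟩ := hk
  let c : ℕ → k := fun w => ψ (w : ℚ)⁻¹
  have hc (w : ℕ) (hw : w ≠ 0) : c w * w = 1 := by
    rw [← map_natCast ψ w, ← map_mul, inv_mul_cancel₀ (Nat.cast_ne_zero.2 hw), map_one]
  refine quasiIso_inl_of_locally r fun p x => ?_
  suffices h : ∃ N, ∀ N', N ≤ N' → (derivationProd (coprodDerivation O H n) c r N').f p x =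
      ((projection O M n).app r).f p x by
    obtain ⟨N, hN⟩ := h
    exact ⟨_, homologyMap_derivationProd _ c r N, hN N le_rfl⟩
  induction mem_span_isOfWeight O H n x using Submodule.span_induction with
  | mem y hy =>
    obtain ⟨w, hy₁, hy₂⟩ := hy
    refine ⟨w, fun N hN => ?_⟩
    rcases eq_or_ne w 0 with rfl | hw
    · rw [Nat.cast_zero, zero_smul] at hy₁
      rw [derivationProd_of_zero c hy₁, hy₂, pow_zero, one_smul]
    · rw [derivationProd_of_weight c hc hw hy₁ hN, hy₂, zero_pow hw, zero_smul]
  | zero => exact ⟨0, fun N _ => by rw [map_zero, map_zero]⟩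
  | add y z _ _ hy hz =>
    obtain ⟨N₁, h₁⟩ := hy
    obtain ⟨N₂, h₂⟩ := hz
    exact ⟨max N₁ N₂, fun N hN => by
      rw [map_add, map_add, h₁ N (le_of_max_le_left hN), h₂ N (le_of_max_le_right hN)]⟩
  | smul t y _ hy =>
    obtain ⟨N₁, h₁⟩ := hy
    exact ⟨N₁, fun N hN => by rw [map_smul, map_smul, h₁ N hN]⟩

end DGOperad

/-! ### Operads without operations of arity zero -/

namespace DGOperad

open CochainComplex HomologicalComplex

variable {k : Type u} [CommRing k]

section Path

variable (P : DGOperad k)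

/-- The projection of `pathOperad P` to the first component. -/
def pathFst : pathOperad P ⟶ P :=
  Hom.mk (fun _ => homotopyFst (𝟙 _)) (fun _ => rfl) rfl (fun _ _ _ _ _ _ _ _ => rfl)

/-- The section of `pathFst` that corresponds to constant families. -/
def pathConst : P ⟶ pathOperad P :=
  Hom.mk (fun _ => homotopyLift (𝟙 _) (fun _ => 𝟙 _) (fun _ _ => 0) (by intros; simp))
    (fun σ => by
      ext p x
      exact homotopyComplex_ext rfl (fun _ => rfl)
        (fun _ => (map_zero ((P.act σ).f _).hom).symm))
    rfl
    (fun i e _ _ _ h a b => (P.pathComp_pathTriple i e h a b).symm)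

variable {P} (φ : P ⟶ pathOperad P)

/-- The endomorphism of the complex `P(n)` at the input `j` of a morphism to `pathOperad`, which acts
on the operations along the path from the root to `j`. -/
def pathMap {n : ℕ} (j : Fin n) : P.cx n ⟶ P.cx n := homotopySnd (φ.app n) j

theorem pathMap_apply {n : ℕ} (j : Fin n) {p : ℤ} (x : (P.cx n).X p) :
    (pathMap φ j).f p x = ((φ.app n).f p x).2.1 j := rfl

theorem pathMap_act {n : ℕ} (j : Fin n) {p : ℤ} (σ : Equiv.Perm (Fin n)) (x : (P.cx n).X p) :
    (pathMap φ j).f p ((P.act σ).f p x) = (P.act σ).f p ((pathMap φ (σ.symm j)).f p x) :=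
  congrArg (fun y => y.2.1 j) (φ.map_act_apply σ x)

theorem pathMap_one (j : Fin 1) : (pathMap φ j).f 0 P.one = P.one :=
  congrArg (fun y => y.2.1 j) φ.map_one

/-- The composite of the endomorphisms `pathMap φ j` for `j` in a list. -/
def pathListMap {n : ℕ} : List (Fin n) → (P.cx n ⟶ P.cx n)
  | [] => 𝟙 _
  | j :: L => pathMap φ j ≫ pathListMap L

theorem pathListMap_cons_apply {n : ℕ} (j : Fin n) (L : List (Fin n)) {p : ℤ}
    (x : (P.cx n).X p) :
    (pathListMap φ (j :: L)).f p x = (pathListMap φ L).f p ((pathMap φ j).f p x) := rfl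

theorem pathListMap_act {n : ℕ} (L : List (Fin n)) {p : ℤ} (σ : Equiv.Perm (Fin n))
    (x : (P.cx n).X p) :
    (pathListMap φ L).f p ((P.act σ).f p x) =
      (P.act σ).f p ((pathListMap φ (L.map σ.symm)).f p x) := by
  induction L generalizing x with
  | nil => rfl
  | cons j L ih => rw [pathListMap_cons_apply, pathMap_act, ih]; rfl

theorem pathListMap_of_fixed {n : ℕ} (L : List (Fin n)) {p : ℤ} {x : (P.cx n).X p}
    (hx : ∀ j, (pathMap φ j).f p x = x) : (pathListMap φ L).f p x = x := by
  induction L with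
  | nil => rfl
  | cons j L ih => rw [pathListMap_cons_apply, hx, ih]

variable {φ}

theorem homologyMap_pathMap (hφ : ∀ n p (x : (P.cx n).X p), ((φ.app n).f p x).1 = x) {n : ℕ}
    (j : Fin n) (q : ℤ) : homologyMap (pathMap φ j) q = 𝟙 _ := by
  have h := (homotopyThd (φ.app n) j).homologyMap_eq q
  have h₁ : homotopyFst (φ.app n) = 𝟙 _ := by
    ext p x
    exact hφ n p x
  rw [one_smul, neg_one_smul, ← sub_eq_add_neg, homologyMap_sub, homologyMap_zero, h₁,
    homologyMap_id, sub_eq_zero] at h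
  exact h.symm

theorem homologyMap_pathListMap (hφ : ∀ n p (x : (P.cx n).X p), ((φ.app n).f p x).1 = x) {n : ℕ}
    (L : List (Fin n)) (q : ℤ) : homologyMap (pathListMap φ L) q = 𝟙 _ := by
  induction L with
  | nil => exact homologyMap_id _ _
  | cons j L ih =>
    rw [pathListMap, homologyMap_comp, ih, homologyMap_pathMap hφ, Category.id_comp]

/-- The list of paths that the paths to the inputs in `L` of a partial composition induce in its
second operation. -/
def innerInputs {m n l : ℕ} {i : Fin m} (e : {x : Fin m // x ≠ i} ⊕ Fin n ≃ Fin l)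
    (L : List (Fin l)) : List (Fin n) :=
  L.filterMap fun j => (e.symm j).getRight?

/-- The list of paths that the paths to the inputs in `L` of a partial composition induce in its
first operation. -/
def outerInputs {m n l : ℕ} {i : Fin m} (e : {x : Fin m // x ≠ i} ⊕ Fin n ≃ Fin l)
    (L : List (Fin l)) : List (Fin m) :=
  L.map fun j => Sum.elim Subtype.val (fun _ => i) (e.symm j)

theorem pathListMap_comp (hφ : ∀ n p (x : (P.cx n).X p), ((φ.app n).f p x).1 = x)
    {m n l : ℕ} (i : Fin m) (e : {x : Fin m // x ≠ i} ⊕ Fin n ≃ Fin l)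
    {p q r : ℤ} (h : p + q = r) (a : (P.cx m).X p) (b : (P.cx n).X q) (L : List (Fin l)) :
    (pathListMap φ L).f r (P.comp i e h a b) =
      P.comp i e h ((pathListMap φ (outerInputs e L)).f p a)
        ((pathListMap φ (innerInputs e L)).f q b) := by
  induction L generalizing a b with
  | nil => rfl
  | cons j L ih =>
    have h₁ := congrArg (fun y => y.2.1 j) (φ.map_comp i e h a b)
    obtain ⟨⟨w, hw⟩ | w, rfl⟩ := e.surjective j
    · have h₂ : (pathMap φ (e (.inl ⟨w, hw⟩))).f r (P.comp i e h a b) =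
          P.comp i e h ((pathMap φ w).f p a) b := by
        refine h₁.trans ((P.pathComp_snd_inl i e h _ _ w hw).trans ?_)
        rw [hφ]
        rfl
      rw [pathListMap_cons_apply, h₂, ih]
      simp [outerInputs, innerInputs, pathListMap_cons_apply]
    · have h₂ : (pathMap φ (e (.inr w))).f r (P.comp i e h a b) =
          P.comp i e h ((pathMap φ i).f p a) ((pathMap φ w).f q b) :=
        h₁.trans (P.pathComp_snd_inr i e h _ _ w)
      rw [pathListMap_cons_apply, h₂, ih]
      simp [outerInputs, innerInputs, pathListMap_cons_apply]

theorem mem_innerInputs {m n l : ℕ} {i : Fin m} (e : {x : Fin m // x ≠ i} ⊕ Fin n ≃ Fin l)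
    {L : List (Fin l)} (hL : ∀ j, j ∈ L) (w : Fin n) : w ∈ innerInputs e L := by
  rw [innerInputs, List.mem_filterMap]
  exact ⟨e (.inr w), hL _, by simp⟩

/-- The path to the input `i` at which the second operation is inserted occurs only if that operation
has an input itself, hence the hypothesis `hn`. -/
theorem mem_outerInputs {m n l : ℕ} (hn : 0 < n) {i : Fin m}
    (e : {x : Fin m // x ≠ i} ⊕ Fin n ≃ Fin l) {L : List (Fin l)} (hL : ∀ j, j ∈ L) (w : Fin m) :
    w ∈ outerInputs e L := by
  rw [outerInputs, List.mem_map]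
  by_cases hw : w = i
  · exact ⟨e (.inr ⟨0, hn⟩), hL _, by simp [hw]⟩
  · exact ⟨e (.inl ⟨w, hw⟩), hL _, by simp⟩

end Path

section CoprodPath

variable (O : DGOperad k) {M : CochainComplex (ModuleCat.{u} k) ℤ} (H : Homotopy (𝟙 M) 0) (n : ℕ)

/-- The endomorphisms of the complexes of operations of `O ⨿ F(M, n)` that kill the elements of `M`
along the path from the root to an input, with homotopies from the identity that are given by the
contraction of `M`. -/
noncomputable def coprodPath : O ⨿ freeOperad M n ⟶ pathOperad (O ⨿ freeOperad M n) :=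
  coprod.desc (coprod.inl ≫ pathConst _) (freeOperad.lift
    (homotopyLift (coprodGen O M n) (fun _ => 0)
      (fun _ p => ((coprodGen O M n).f (p - 1)).hom.comp (contraction H p))
      (fun _ p p' hp x => by
        have h := congrArg ((coprodGen O M n).f (p' - 1)) (contraction_spec H hp x)
        rw [map_sub, map_castX, map_d] at h
        have h₀ : (0 : M ⟶ (O ⨿ freeOperad M n).cx n).f p x = 0 := rfl
        rw [one_smul, h₀, smul_zero, add_zero]
        exact h)))

theorem coprodPath_inl {m : ℕ} {p : ℤ} (x : (O.cx m).X p) :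
    ((coprodPath O H n).app m).f p
        ((Hom.app (coprod.inl : O ⟶ O ⨿ freeOperad M n) m).f p x) =
      ((Hom.app (coprod.inl : O ⟶ O ⨿ freeOperad M n) m).f p x,
        fun _ => (Hom.app (coprod.inl : O ⟶ O ⨿ freeOperad M n) m).f p x, fun _ => 0) :=
  congrArg (fun f : O ⟶ pathOperad (O ⨿ freeOperad M n) => (f.app m).f p x)
    (coprod.inl_desc _ _)

theorem coprodPath_gen {p : ℤ} (x : M.X p) :
    ((coprodPath O H n).app n).f p ((coprodGen O M n).f p x) =
      ((coprodGen O M n).f p x, fun _ => 0,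
        fun _ => (coprodGen O M n).f (p - 1) (contraction H p x)) :=
  congrArg (fun f : M ⟶ (pathOperad (O ⨿ freeOperad M n)).cx n => f.f p x)
    (coprodGen_desc _ _)

theorem coprodPath_fst {m : ℕ} {p : ℤ} (x : ((O ⨿ freeOperad M n).cx m).X p) :
    (((coprodPath O H n).app m).f p x).1 = x := by
  have h : coprodPath O H n ≫ pathFst _ = 𝟙 _ := by
    refine coprod_free_hom_ext ?_ ?_
    · ext m p x
      exact congrArg Prod.fst (coprodPath_inl O H n x)
    · ext p x
      exact congrArg Prod.fst (coprodPath_gen O H n x)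
  exact congrArg (fun f : O ⨿ freeOperad M n ⟶ O ⨿ freeOperad M n => (f.app m).f p x) h

theorem projection_eq_zero (hO : IsZero (O.cx 0)) {p : ℤ}
    (x : ((O ⨿ freeOperad M n).cx 0).X p) : ((projection O M n).app 0).f p x = 0 := by
  have h : Hom.app (projection O M n) 0 = 0 := by
    rw [projection, comp_app, hO.eq_zero_of_tgt ((retraction O M n).app 0), zero_comp]
  rw [h]
  rfl

/-- Every element of `M` in an operation lies on the path from the root to some input, as there are
no operations of arity zero. -/
theorem pathListMap_eq_projection (hO : IsZero (O.cx 0)) (hn : 0 < n) {m : ℕ} {p : ℤ}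
    (x : ((O ⨿ freeOperad M n).cx m).X p) (L : List (Fin m)) (hL : ∀ j, j ∈ L) :
    (pathListMap (coprodPath O H n) L).f p x = ((projection O M n).app m).f p x := by
  have hφ (m p) (x : ((O ⨿ freeOperad M n).cx m).X p) := coprodPath_fst O H n x
  refine IsClosedPred.coprod (S := fun m p x => ∀ L : List (Fin m), (∀ j, j ∈ L) →
    (pathListMap (coprodPath O H n) L).f p x = ((projection O M n).app m).f p x) ?_ ?_ ?_ x L hL
  · exact
    { zero := fun _ _ _ _ => by rw [map_zero, map_zero]
      add := fun ha hb L hL => by rw [map_add, map_add, ha L hL, hb L hL]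
      smul := fun c a ha L hL => by rw [map_smul, map_smul, ha L hL]
      diff := fun h a ha L hL => by rw [map_d, map_d, ha L hL]
      act := fun {m p} σ a ha L hL => by
        rw [pathListMap_act, Hom.map_act_apply,
          ha _ fun j => List.mem_map.2 ⟨σ j, hL _, σ.symm_apply_apply j⟩]
      one := fun L _ => by
        rw [pathListMap_of_fixed _ _ fun j => pathMap_one _ j, Hom.map_one]
      comp := fun {m n' l} i e {p q r} h {a b} ha hb L hL => by
        rw [pathListMap_comp hφ, Hom.map_comp, hb _ (mem_innerInputs e hL)]
        rcases Nat.eq_zero_or_pos n' with rfl | hn'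
        -- The path to `i` need not occur in `outerInputs e L`, but both sides vanish with `b`.
        · rw [projection_eq_zero O n hO, map_zero, map_zero]
        · rw [ha _ (mem_outerInputs hn' e hL)] }
  · intro m p x L _
    rw [projection_inl, pathListMap_of_fixed]
    intro j
    rw [pathMap_apply, coprodPath_inl]
  · intro p x L hL
    rw [projection_gen]
    cases L with
    | nil => exact absurd (hL ⟨0, hn⟩) List.not_mem_nil
    | cons j L => rw [pathListMap_cons_apply, pathMap_apply, coprodPath_gen, map_zero]

end CoprodPath

/-- If `O` has no operations of arity zero, then the inclusion of `O` in the coproduct with a free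
operad on a contractible complex in positive arity is a quasi-isomorphism. -/
theorem quasiIso_inl_of_isZero (O : DGOperad k) {M : CochainComplex (ModuleCat.{u} k) ℤ}
    (H : Homotopy (𝟙 M) 0) (n : ℕ) (hO : IsZero (O.cx 0)) (hn : 0 < n) (r : ℕ) :
    QuasiIso ((coprod.inl : O ⟶ O ⨿ freeOperad M n).app r) :=
  quasiIso_inl_of_locally r fun _ x =>
    ⟨pathListMap (coprodPath O H n) (List.finRange r),
      homologyMap_pathListMap (fun _ _ x => coprodPath_fst O H n x) _,
      pathListMap_eq_projection O H n hO hn x _ List.mem_finRange⟩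

end DGOperad

theorem mainTheorem1 (k : Type u) [CommRing k] (O : DGOperad.{u} k) (s : ℤ) (n : ℕ)
    (h : (IsZero (O.cx 0) ∧ 0 < n) ∨ Nonempty (ℚ →+* k)) (r : ℕ) :
    QuasiIso ((coprod.inl : O ⟶ O ⨿ freeOperad (shiftedCone k s) n).app r) := by
  rcases h with ⟨hO, hn⟩ | hk
  · exact DGOperad.quasiIso_inl_of_isZero O (shiftedConeContraction k s) n hO hn r
  · exact DGOperad.quasiIso_inl_of_rat O (shiftedConeContraction k s) n hk r
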